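/- Let $K$ be a field, $G$ a finite group with $\operatorname{char}K\nmid |G|$, and $A=\bigoplus_{g\in G}A_g$ a finite-dimensional $G$-graded $K$-algebra. All modules are left modules. For a $G$-graded algebra $B$ the smash product $B\#G^*$ is the $K$-vector space $B\otimes_K KG^*$ with multiplication $(a\# p_g)(b\# p_h)=a\,b_{gh^{-1}}\# p_h$, where $\{p_g\mid g\in G\}$ is the basis of $KG^*$ dual to $G$ and $b_k$ denotes the component of $b$ of degree $k$. For a graded $A$-module $M=\bigoplus_{g\in G}M_g$ (so $A_gM_h\subseteq M_{gh}$), $M\otimes_K KG^*$ is the $A\#G^*$-module with $(a\# p_g)(m\otimes p_h)=a\,m_{gh^{-1}}\otimes p_h$. For a finite-dimensional algebra $B$ with Jacobson radical $J(B)$, the Yoneda algebra $\operatorname{Ext}^*_B(B/J(B),B/J(B))=\bigoplus_{i\ge 0}\operatorname{Ext}^i_B(B/J(B),B/J(B))$ carries the Yoneda product, $\alpha\beta$ meaning first $\alpha$, then $\beta$. The algebra $B$ is quasi-Koszul if $E=\operatorname{Ext}^*_B(B/J(B),B/J(B))$ is generated in degrees $0$ and $1$, that is, $E_i=E_1^i$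 for all $i\ge 2$; a $B$-module $X$ is quasi-Koszul if $\operatorname{Ext}^i_B(X,B/J(B))\operatorname{Ext}^1_B(B/J(B),B/J(B))=\operatorname{Ext}^{i+1}_B(X,B/J(B))$ for all $i\ge 0$, where the product of two spaces is the span of all products. Write $J=J(A)$. Then: 1. For every finitely generated graded $A$-module $M$, $M\otimes_K KG^*$ is a quasi-Koszul $A\#G^*$-module if and only if $M$ is a quasi-Koszul $A$-module. 2. The algebra $A\#G^*$ is quasi-Koszul if and only if $A$ is quasi-Koszul. 3. $J$ is a homogeneous ideal, so that $A/J$ is a graded $A$-module with $(A/J)_g$ the image of $A_g$. The Yoneda algebra $\operatorname{Ext}^*_A(A/J,A/J)$ is a $G$-graded $K$-algebra, where the component of degree $g$ of $\operatorname{Ext}^i_A(A/J,A/J)$ consists of the classes of the cocycles $f:P_i\to A/J$ with $f((P_i)_h)\subseteq (A/J)_{hg}$ for all $h\in G$, for graded projective resolutions $P_\bullet$ of $A/J$. There is an isomorphism of $K$-algebras $$\operatorname{Ext}^*_{A\#G^*}\big((A\#G^*)/J(A\#G^*),(A\#G^*)/J(A\#G^*)\big)\;\cong\;\operatorname{Ext}^*_A(A/J,A/J)\#G^*$$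 that is an isomorphism of graded algebras with respect to the grading by $i\ge 0$, that is, it maps $\operatorname{Ext}^i_{A\#G^*}$ onto $\operatorname{Ext}^i_A(A/J,A/J)\otimes_K KG^*$ for every $i$. -/

import Mathlib

open CategoryTheory CategoryTheory.Abelian DirectSum

universe u v w

set_option linter.unusedSectionVars false

noncomputable section

namespace QuasiKoszul

/-! ### The graded algebra `Ext^*(X, X)` with the Yoneda product -/

section SelfExt

variable {C : Type w} [Category.{v} C] [Abelian C] [HasExt.{u} C]

/-- The family of groups `Ext^i(X, X)`, `i ≥ 0`. -/
abbrev SelfExt (X : C) (i : ℕ) : Type u := Ext X X i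

theorem sigma_comp {X Y Z : C} {a b c d : ℕ} (α : Ext X Y a) (β : Ext Y Z b) (h : a + b = c)
    (h' : a + b = d) :
    (⟨c, α.comp β h⟩ : GradedMonoid fun n => Ext X Z n) = ⟨d, α.comp β h'⟩ := by
  subst h
  subst h'
  rfl

/-- The product of `α` and `β` is "first `α`, then `β`", as is usual for the Yoneda product. -/
instance (X : C) : GradedMonoid.GMul (SelfExt X) where
  mul α β := Ext.comp α β rfl

instance (X : C) : GradedMonoid.GOne (SelfExt X) where
  one := Ext.mk₀ (𝟙 X)

instance (X : C) : GradedMonoid.GMonoid (SelfExt X) where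
  one_mul := by
    rintro ⟨i, α⟩
    refine (sigma_comp (Ext.mk₀ (𝟙 X)) α rfl (zero_add i)).trans ?_
    rw [Ext.mk₀_id_comp]
  mul_one := by
    rintro ⟨i, α⟩
    refine (sigma_comp α (Ext.mk₀ (𝟙 X)) rfl (add_zero i)).trans ?_
    rw [Ext.comp_mk₀_id]
  mul_assoc := by
    rintro ⟨i, α⟩ ⟨j, β⟩ ⟨k, γ⟩
    refine (sigma_comp (Ext.comp α β rfl) γ rfl (add_assoc i j k)).trans ?_
    rw [Ext.comp_assoc α β γ rfl rfl (add_assoc i j k)]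
    rfl

instance (X : C) : DirectSum.GRing (SelfExt X) where
  mul_zero α := Ext.comp_zero α X _ _ rfl
  zero_mul β := Ext.zero_comp _ _ β _ rfl
  mul_add α β γ := Ext.comp_add α β γ _
  add_mul α β γ := Ext.add_comp α β γ _
  natCast n := n • (Ext.mk₀ (𝟙 X) : Ext X X 0)
  natCast_zero := zero_smul _ _
  natCast_succ _ := succ_nsmul _ _
  intCast n := n • (Ext.mk₀ (𝟙 X) : Ext X X 0)
  intCast_ofNat _ := natCast_zsmul _ _
  intCast_negSucc_ofNat _ := negSucc_zsmul _ _

instance (K : Type*) [Field K] [Linear K C] (X : C) : DirectSum.GAlgebra K (SelfExt X) where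
  toFun :=
    { toFun := fun r => r • (Ext.mk₀ (𝟙 X) : Ext X X 0)
      map_zero' := zero_smul _ _
      map_add' := fun r s => add_smul r s _ }
  map_one := one_smul _ _
  map_mul r s := by
    symm
    refine (sigma_comp (r • (Ext.mk₀ (𝟙 X))) (s • Ext.mk₀ (𝟙 X)) rfl (zero_add 0)).trans ?_
    rw [Ext.smul_comp, Ext.comp_smul, smul_smul, Ext.mk₀_id_comp]
    rfl
  commutes := by
    rintro r ⟨i, α⟩
    refine (sigma_comp (r • (Ext.mk₀ (𝟙 X))) α rfl (zero_add i)).trans ?_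
    refine Eq.trans ?_ (sigma_comp α (r • (Ext.mk₀ (𝟙 X))) (add_zero i) rfl)
    rw [Ext.smul_comp, Ext.comp_smul, Ext.comp_mk₀_id, Ext.mk₀_id_comp]
  smul_def := by
    rintro r ⟨i, α⟩
    symm
    refine (sigma_comp (r • (Ext.mk₀ (𝟙 X))) α rfl (zero_add i)).trans ?_
    rw [Ext.smul_comp, Ext.mk₀_id_comp]
    rfl

end SelfExt

/-! ### Quasi-Koszul modules and algebras -/

section Koszul

variable (K : Type*) [Field K] (A : Type u) [Ring A] [Algebra K A]

/-- The left `A`-module `A / J`, where `J` is the Jacobson radical of `A`. -/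
abbrev semisimpleTop : ModuleCat.{u} A := ModuleCat.of A (A ⧸ Ring.jacobson A)

/-- The Yoneda algebra `Ext^*_A(A/J, A/J)`. It is a `K`-algebra. -/
abbrev Yoneda : Type u := ⨁ i, SelfExt (semisimpleTop A) i

/-- The degree `i` part `Ext^i_A(A/J, A/J)` of the Yoneda algebra. -/
def yonedaDegree (i : ℕ) : Submodule K (Yoneda A) :=
  LinearMap.range (DirectSum.lof K ℕ (SelfExt (semisimpleTop A)) i)

/-- A graded algebra `E = ⨁ E_i` is generated in degrees `0` and `1` if `E_i = E_1 ^ i` for all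
`i ≥ 2`; `A` is quasi-Koszul if its Yoneda algebra is. -/
def IsQuasiKoszulAlgebra : Prop :=
  ∀ i : ℕ, 2 ≤ i → yonedaDegree K A i = yonedaDegree K A 1 ^ i

/-- `Ext^i_A(M, A/J) Ext^1_A(A/J, A/J) = Ext^{i+1}_A(M, A/J)` for all `i ≥ 0`, where the product
of two spaces is the `K`-linear span of the Yoneda products. -/
def IsQuasiKoszulModule (M : Type u) [AddCommGroup M] [Module A M] : Prop :=
  ∀ i : ℕ, Submodule.span K
    {γ : Ext (ModuleCat.of A M) (semisimpleTop A) (i + 1) |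
      ∃ (α : Ext (ModuleCat.of A M) (semisimpleTop A) i)
        (β : Ext (semisimpleTop A) (semisimpleTop A) 1), α.comp β rfl = γ} = ⊤

end Koszul

/-! ### The smash product

Groups are written additively (as always for gradings in Mathlib), but are not assumed to be
commutative. -/

section Smash

variable {K : Type*} [Field K] {G : Type*} [AddGroup G] [Fintype G] [DecidableEq G]

section Ring

variable {A : Type*} [Ring A] [Algebra K A] (𝒜 : G → Submodule K A)

/-- The smash product `A # G^* = A ⊗_K KG^*` of a `G`-graded algebra. As the dual basis `p_g`
is a basis of `KG^*`, an element is uniquely of the form `∑ g, a_g # p_g`, and is given by the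
family `(a_g)`. -/
def Smash (_𝒜 : G → Submodule K A) : Type _ := G → A

instance : AddCommGroup (Smash 𝒜) := inferInstanceAs (AddCommGroup (G → A))

instance : Module K (Smash 𝒜) := inferInstanceAs (Module K (G → A))

/-- The element `a # p_g`. -/
def Smash.single (a : A) (g : G) : Smash 𝒜 := Pi.single g a

variable [GradedAlgebra 𝒜]

/-- The bilinear product with `(a # p_g) (b # p_h) = a b_{g - h} # p_h`. -/
instance : Mul (Smash 𝒜) where
  mul x y := fun h => ∑ g, x g * GradedRing.proj 𝒜 (g - h) (y h)

instance : One (Smash 𝒜) where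
  one := fun _ => (1 : A)

theorem Smash.mul_apply (x y : Smash 𝒜) (h : G) :
    (x * y) h = ∑ g, x g * GradedRing.proj 𝒜 (g - h) (y h) := rfl

theorem Smash.one_apply (h : G) : (1 : Smash 𝒜) h = (1 : A) := rfl

theorem Smash.add_apply (x y : Smash 𝒜) (h : G) : (x + y) h = x h + y h := rfl

theorem Smash.zero_apply (h : G) : (0 : Smash 𝒜) h = (0 : A) := rfl

theorem Smash.smul_apply (r : K) (x : Smash 𝒜) (h : G) : (r • x) h = r • x h := rfl

theorem sum_proj_sub (a : A) (h : G) : ∑ g, GradedRing.proj 𝒜 (g - h) a = a := by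
  rw [Fintype.sum_equiv (Equiv.subRight h) (fun g => GradedRing.proj 𝒜 (g - h) a)
    (fun g => GradedRing.proj 𝒜 g a) (fun _ => rfl)]
  simp only [GradedRing.proj_apply]
  classical
  conv_rhs => rw [← DirectSum.sum_support_decompose 𝒜 a]
  symm
  apply Finset.sum_subset (Finset.subset_univ _)
  intro g _ hg
  simpa using hg

theorem proj_mul_proj (a b : A) (g h k : G) :
    GradedRing.proj 𝒜 (g - k) (a * GradedRing.proj 𝒜 (h - k) b) =
      GradedRing.proj 𝒜 (g - h) a * GradedRing.proj 𝒜 (h - k) b := by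
  rw [← sub_add_sub_cancel g h k]
  exact DirectSum.coe_decompose_mul_add_of_right_mem 𝒜 (SetLike.coe_mem _)

theorem proj_sub_one (g h : G) :
    GradedRing.proj 𝒜 (g - h) (1 : A) = if g = h then 1 else 0 := by
  rw [GradedRing.proj_apply]
  split_ifs with hgh
  · subst hgh
    rw [sub_self, DirectSum.decompose_of_mem_same 𝒜 (SetLike.GradedOne.one_mem)]
  · rw [DirectSum.decompose_of_mem_ne 𝒜 (SetLike.GradedOne.one_mem)]
    exact fun h0 => hgh (sub_eq_zero.mp h0.symm)

instance : Ring (Smash 𝒜) where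
  __ := (inferInstance : AddCommGroup (Smash 𝒜))
  left_distrib x y z := by
    funext h
    simp only [Smash.mul_apply, Smash.add_apply, map_add, mul_add, Finset.sum_add_distrib]
  right_distrib x y z := by
    funext h
    simp only [Smash.mul_apply, Smash.add_apply, add_mul, Finset.sum_add_distrib]
  zero_mul x := by
    funext h
    simp [Smash.mul_apply, Smash.zero_apply]
  mul_zero x := by
    funext h
    simp [Smash.mul_apply, Smash.zero_apply]
  mul_assoc x y z := by
    funext k
    simp only [Smash.mul_apply, map_sum, Finset.sum_mul, Finset.mul_sum, proj_mul_proj, mul_assoc]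
    rw [Finset.sum_comm]
  one_mul x := by
    funext h
    simp only [Smash.mul_apply, Smash.one_apply, one_mul, sum_proj_sub]
  mul_one x := by
    funext h
    simp only [Smash.mul_apply, Smash.one_apply, proj_sub_one]
    rw [Finset.sum_eq_single h (fun g _ hg => by rw [if_neg hg, mul_zero]) (by simp), if_pos rfl,
      mul_one]

theorem proj_smul' (r : K) (g : G) (a : A) :
    GradedRing.proj 𝒜 g (r • a) = r • GradedRing.proj 𝒜 g a := by
  rw [GradedRing.proj_apply, DirectSum.decompose_smul]
  rfl

instance : Algebra K (Smash 𝒜) :=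
  Algebra.ofModule
    (fun r x y => by
      funext h
      simp only [Smash.mul_apply, Smash.smul_apply, smul_mul_assoc, Finset.smul_sum])
    (fun r x y => by
      funext h
      simp only [Smash.mul_apply, Smash.smul_apply, proj_smul', mul_smul_comm, Finset.smul_sum])

theorem Smash.single_mul_single (a b : A) (g h : G) :
    Smash.single 𝒜 a g * Smash.single 𝒜 b h =
      Smash.single 𝒜 (a * GradedRing.proj 𝒜 (g - h) b) h := by
  funext k
  rw [Smash.mul_apply]
  unfold Smash.single
  rw [Finset.sum_eq_single g (fun l _ hl => by simp [Pi.single_eq_of_ne hl]) (by simp)]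
  by_cases hk : k = h
  · subst hk
    simp
  · simp [Pi.single_eq_of_ne hk]

/-- For a subspace `S` of `A`, the subspace `S # G^* = S ⊗_K KG^*` of `A # G^*`. -/
def smashSubmodule (S : Submodule K A) : Submodule K (Smash 𝒜) :=
  Submodule.pi Set.univ fun _ : G => S

end Ring

section Module

variable {A : Type*} [Ring A] [Algebra K A] (𝒜 : G → Submodule K A) [GradedAlgebra 𝒜]
  {M : Type*} [AddCommGroup M] [Module K M] [Module A M] (ℳ : G → Submodule K M)

/-- The module `M ⊗_K KG^*` over `A # G^*`; the element `∑ g, m_g ⊗ p_g` is given by the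
family `(m_g)`. -/
def SmashModule (_𝒜 : G → Submodule K A) (_ℳ : G → Submodule K M) : Type _ := G → M

instance : AddCommGroup (SmashModule 𝒜 ℳ) := inferInstanceAs (AddCommGroup (G → M))

variable [DirectSum.Decomposition ℳ]

/-- The bilinear action with `(a ⊗ p_g) (m ⊗ p_h) = a m_{g - h} ⊗ p_h`. -/
instance : SMul (Smash 𝒜) (SmashModule 𝒜 ℳ) where
  smul x m := fun h => ∑ g, x g • (DirectSum.decompose ℳ (m h) (g - h) : M)

theorem SmashModule.smul_apply (x : Smash 𝒜) (m : SmashModule 𝒜 ℳ) (h : G) :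
    (x • m) h = ∑ g, x g • (DirectSum.decompose ℳ (m h) (g - h) : M) := rfl

theorem SmashModule.add_apply (m n : SmashModule 𝒜 ℳ) (h : G) : (m + n) h = m h + n h := rfl

theorem SmashModule.zero_apply (h : G) : (0 : SmashModule 𝒜 ℳ) h = (0 : M) := rfl

theorem sum_decompose_sub (m : M) (h : G) :
    ∑ g, (DirectSum.decompose ℳ m (g - h) : M) = m := by
  rw [Fintype.sum_equiv (Equiv.subRight h) (fun g => (DirectSum.decompose ℳ m (g - h) : M))
    (fun g => (DirectSum.decompose ℳ m g : M)) (fun _ => rfl)]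
  classical
  conv_rhs => rw [← DirectSum.sum_support_decompose ℳ m]
  symm
  apply Finset.sum_subset (Finset.subset_univ _)
  intro g _ hg
  simpa using hg

theorem coe_decompose_sum (f : G → M) (g : G) :
    (DirectSum.decompose ℳ (∑ l, f l) g : M) = ∑ l, (DirectSum.decompose ℳ (f l) g : M) := by
  induction (Finset.univ : Finset G) using Finset.induction_on with
  | empty => simp
  | insert a s ha ih =>
    rw [Finset.sum_insert ha, Finset.sum_insert ha, DirectSum.decompose_add, ← ih]
    rfl

theorem decompose_smul_decompose [SetLike.GradedSMul 𝒜 ℳ] (a : A) (m : M) (g h k : G) :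
    (DirectSum.decompose ℳ (a • (DirectSum.decompose ℳ m (h - k) : M)) (g - k) : M) =
      GradedRing.proj 𝒜 (g - h) a • (DirectSum.decompose ℳ m (h - k) : M) := by
  have key : ∀ l : G,
      (DirectSum.decompose ℳ
        (GradedRing.proj 𝒜 (l - h) a • (DirectSum.decompose ℳ m (h - k) : M)) (g - k) : M) =
      if l = g then GradedRing.proj 𝒜 (g - h) a • (DirectSum.decompose ℳ m (h - k) : M) else 0 := by
    intro l
    have hmem : GradedRing.proj 𝒜 (l - h) a • (DirectSum.decompose ℳ m (h - k) : M) ∈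
        ℳ (l - k) := by
      rw [← sub_add_sub_cancel l h k]
      exact SetLike.GradedSMul.smul_mem
        (SetLike.coe_mem (DirectSum.decompose 𝒜 a (l - h)))
        (SetLike.coe_mem (DirectSum.decompose ℳ m (h - k)))
    split_ifs with hl
    · subst hl
      exact DirectSum.decompose_of_mem_same ℳ hmem
    · exact DirectSum.decompose_of_mem_ne ℳ hmem (fun h0 => hl (sub_left_injective h0))
  conv_lhs => rw [← sum_proj_sub 𝒜 a h]
  rw [Finset.sum_smul, coe_decompose_sum]
  simp only [key]
  simp

instance [SetLike.GradedSMul 𝒜 ℳ] : Module (Smash 𝒜) (SmashModule 𝒜 ℳ) where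
  one_smul m := by
    funext h
    simp only [SmashModule.smul_apply, Smash.one_apply, one_smul, sum_decompose_sub]
  mul_smul x y m := by
    funext k
    simp only [SmashModule.smul_apply, Smash.mul_apply, coe_decompose_sum, Finset.smul_sum,
      Finset.sum_smul, decompose_smul_decompose 𝒜 ℳ, mul_smul]
    rw [Finset.sum_comm]
  smul_zero x := by
    funext h
    simp [SmashModule.smul_apply, SmashModule.zero_apply]
  zero_smul m := by
    funext h
    simp [SmashModule.smul_apply, SmashModule.zero_apply, Smash.zero_apply]
  smul_add x m n := by
    funext h
    simp [SmashModule.smul_apply, SmashModule.add_apply, DirectSum.decompose_add, smul_add,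
      Finset.sum_add_distrib]
  add_smul x y m := by
    funext h
    simp only [SmashModule.smul_apply, SmashModule.add_apply, Smash.add_apply, add_smul,
      Finset.sum_add_distrib]

end Module

end Smash

/-! ### The grading by `G` on `Ext` -/

section ExtGrading

variable {K : Type*} [Field K] {G : Type*} [AddGroup G] [DecidableEq G]
  {A : Type u} [Ring A] [Algebra K A] (𝒜 : G → Submodule K A)

/-- A graded projective resolution of an `A`-module `X` graded by `𝒳`: a projective resolution
whose terms are graded `A`-modules and whose differentials and augmentation preserve degrees. -/
structure GradedResolution (X : ModuleCat.{u} A) (𝒳 : G → AddSubgroup X) extends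
    ProjectiveResolution X where
  /-- the homogeneous components of the terms -/
  grading : ∀ n, G → AddSubgroup (complex.X n)
  isInternal : ∀ n, DirectSum.IsInternal (grading n)
  smul_mem : ∀ n (g h : G) (a : A) (x : complex.X n), a ∈ 𝒜 g → x ∈ grading n h →
    a • x ∈ grading n (g + h)
  d_mem : ∀ n (g : G) (x : complex.X (n + 1)), x ∈ grading (n + 1) g →
    (complex.d (n + 1) n).hom x ∈ grading n g
  augmentation_mem : ∀ (g : G) (x : complex.X 0), x ∈ grading 0 g →
    (show complex.X 0 ⟶ X from π.f 0).hom x ∈ 𝒳 g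

/-- The component of degree `g` of `Ext^i_A(X, Y)` for graded modules `X` and `Y`: it consists of
the classes of those cocycles `f : P_i → Y`, for `P` a graded projective resolution of `X`, that
have degree `g`, that is, map the component of degree `h` to the component of degree `h + g`.
(These classes do not depend on `P` and form a subspace, so taking the span adds nothing.) -/
def extDegree (X Y : ModuleCat.{u} A) (𝒳 : G → AddSubgroup X) (𝒴 : G → AddSubgroup Y)
    (i : ℕ) (g : G) : Submodule K (Ext X Y i) :=
  Submodule.span K
    {α | ∃ (P : GradedResolution 𝒜 X 𝒳) (f : P.complex.X i ⟶ Y)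
        (hf : P.complex.d (i + 1) i ≫ f = 0),
        (∀ (h : G) (x : P.complex.X i), x ∈ P.grading i h → f.hom x ∈ 𝒴 (h + g)) ∧
        P.toProjectiveResolution.extMk f (i + 1) rfl hf = α}

/-- The component of degree `g` of `A / J`: the image of the component of degree `g` of `A`. -/
def topGrading (g : G) : AddSubgroup (semisimpleTop A) :=
  (𝒜 g).toAddSubgroup.map (Ring.jacobson A).mkQ.toAddMonoidHom

/-- The component of degree `g ∈ G` of the Yoneda algebra `Ext^*_A(A/J, A/J)`: the direct sum over
`i` of the components of degree `g` of the `Ext^i_A(A/J, A/J)`. -/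
def yonedaGrading (g : G) : Submodule K (Yoneda A) :=
  ⨅ i, (extDegree 𝒜 (semisimpleTop A) (semisimpleTop A) (topGrading 𝒜) (topGrading 𝒜) i g).comap
    (DirectSum.component K ℕ (SelfExt (semisimpleTop A)) i)

end ExtGrading

end QuasiKoszul

end

open QuasiKoszul

noncomputable section

namespace QuasiKoszul

/-! ### Identities for images of composite morphisms under functors -/

open Limits

/-! A module over `A # G^*` is the same thing as a graded `A`-module, the idempotents `1 # p_g`
acting as the projections to the components. Let F be the functor that forgets the grading, and let
X(h) be X with all degrees raised by h. F is exact, and it preserves projectives because `A # G^*`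
is free over `A`. Every `A`-linear map F N → X is uniquely the sum of its homogeneous parts, that
is, of graded maps N → X(k) with k in G. Applying this to the terms of a projective resolution gives
Ext_A(X, Y) = ⊕_k Ext(X(h), Y(k)) for each h, with Ext over `A # G^*` on the right
(`bijective_sum_mapExactFunctor`). The k-th summand is the component of degree h - k
(`extDegree_eq_range`), which shows that this component does not depend on a resolution.

The module M ⊗ KG^* is the direct sum of all shifts M(h). The semisimple top of `A # G^*` is
likewise the sum of the shifts of A/J, as soon as J(A # G^*) = J # G^* (`Smash.mem_jacobson_iff`).
The invertibility of |G| enters only through the radical: it permits averaging arguments of Maschke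
type.

A class in Ext between two such sums is therefore a matrix indexed by G × G whose (g, k) entry is
any element of degree g - k in Ext_A(X, Y). The entries of one column have distinct degrees and
exhaust all degrees, so a column is determined by its sum, which is arbitrary: the Ext group is
Ext_A(X, Y)^G (`ShiftSum.column_injective`, `ShiftSum.column_surjective`). The (j, k) entry is the
part of degree j - k of the k-th column sum, so matrix multiplication becomes (βγ)_k = ∑_j β_j
(γ_k)_{j-k} (`ShiftSum.column_comp`). This is the multiplication of the smash product, which gives
the isomorphism of Yoneda algebras. Both statements on quasi-Koszulity follow, since spans of
products can be compared column by column. -/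

theorem map_conj_comm {C D : Type*} [Category* C] [Category* D] (F : C ⥤ D) {a b a' b' : C}
    {A B : D} (P : A ≅ F.obj a') (Q : B ≅ F.obj b') (p : a ≅ a') (q : b ≅ b') (d : a' ⟶ b') :
    (P.hom ≫ F.map p.inv) ≫ F.map (p.hom ≫ d ≫ q.inv) =
      (P.hom ≫ F.map d ≫ Q.inv) ≫ Q.hom ≫ F.map q.inv := by
  simp only [Category.assoc, ← F.map_comp, Iso.inv_hom_id_assoc]

theorem map_conj_augmentation {C D : Type*} [Category* C] [Category* D] (F : C ⥤ D) {a b a' b' : C}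
    {A B : D} (P : A ⟶ F.obj a') (S : B ≅ F.obj b') (p : a ≅ a') (q : b ≅ b') (d : a' ⟶ b') :
    (P ≫ F.map p.inv) ≫ F.map (p.hom ≫ d ≫ q.inv) ≫ F.map q.hom ≫ S.inv =
      P ≫ F.map d ≫ S.inv := by
  simp only [Category.assoc, Iso.inv_hom_id_assoc, ← F.map_comp_assoc,
    Iso.inv_hom_id, Category.comp_id]

theorem map_comp_map_id_comp_id {C D : Type*} [Category* C] [Category* D] (F : C ⥤ D) {a b : C}
    (d : a ⟶ b) : F.map d ≫ F.map (𝟙 b) ≫ 𝟙 (F.obj b) = F.map d := by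
  simp

theorem map_conj_cocycle {C D : Type*} [Category* C] [Category* D] (F : C ⥤ D) {a a' b b' : C}
    {A B : D} (P : A ⟶ F.obj a') (S : B ≅ F.obj b') (p : a ≅ a') (q : b ≅ b') (d : a' ⟶ b') :
    ((P ≫ F.map p.inv) ≫ F.map ((p.hom ≫ d) ≫ q.inv) ≫ F.map q.hom ≫ S.inv) ≫ S.hom =
      P ≫ F.map d := by
  simp only [Category.assoc, ← F.map_comp_assoc, Iso.inv_hom_id_assoc, Iso.inv_hom_id,
    Category.comp_id]

/-- Glues two commutative squares, one at the source and one at the shifted target of a morphism. In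
the derived category `T` is the shift and `n` is the image of a cocycle. -/
theorem comp_shift_conj {D : Type*} [Category* D] (T : D ⥤ D) {x₁ x₂ x₃ x₄ x₅ y₁ y₂ y₃ y₄ y₅ : D}
    {i : x₁ ⟶ x₂} {a : x₂ ⟶ x₃} {e : x₃ ⟶ x₄} {n : x₄ ⟶ T.obj y₁} {e' : y₁ ⟶ y₂} {b : y₂ ⟶ y₃}
    {h : y₃ ⟶ y₄} {a' : x₁ ⟶ x₅} {p : x₅ ⟶ x₄} {s : y₁ ⟶ y₅} {j : y₅ ⟶ y₄}
    (h₁ : i ≫ a ≫ e = a' ≫ p) (h₂ : e' ≫ b ≫ h = s ≫ j) :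
    i ≫ (a ≫ (e ≫ n ≫ T.map e') ≫ T.map b) ≫ T.map h =
      a' ≫ (p ≫ n ≫ T.map s) ≫ T.map j := by
  have h₃ : T.map e' ≫ T.map b ≫ T.map h = T.map s ≫ T.map j := by
    rw [← T.map_comp, ← T.map_comp, h₂, T.map_comp]
  simp only [Category.assoc]
  rw [h₃, reassoc_of% h₁]

theorem comp_map_id_comp {C D : Type*} [Category* C] [Category* D] (F : C ⥤ D) {a : C} {x y : D}
    {f : x ⟶ F.obj a} {g : F.obj a ⟶ y} {h : x ⟶ y} (w : f ≫ g = h) :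
    f ≫ F.map (𝟙 a) ≫ g = h ≫ 𝟙 y := by
  simp [w]

/-- Cancelling the monomorphism `S.map p` turns an identity about the inverse of `Q.map p` into
naturality of `e`. Here `p` will be the augmentation of a resolution and `Q` the localization
functor. -/
theorem comp_map_inv_comp {C D E : Type*} [Category* C] [Category* D] [Category* E] (Q : C ⥤ D)
    (T : D ⥤ E) (S : C ⥤ E) (e : Q ⋙ T ⟶ S) {a b : C} (p : a ⟶ b) [IsIso (Q.map p)]
    {x z : E} {i : x ⟶ T.obj (Q.obj b)} {j : x ⟶ S.obj b} (h : i ≫ e.app b = j)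
    {P : z ⟶ x} [hP : IsIso P] {φ : z ⟶ S.obj a} (w : φ ≫ S.map p = P ≫ j) [Mono (S.map p)] :
    i ≫ T.map (𝟙 _ ≫ inv (Q.map p)) ≫ e.app a = (𝟙 x ≫ inv P) ≫ φ := by
  rw [Category.id_comp, Category.id_comp, ← cancel_mono (S.map p), Category.assoc, Category.assoc,
    Category.assoc, w, IsIso.inv_hom_id_assoc, ← e.naturality, ← h, Functor.comp_map,
    ← T.map_comp_assoc, IsIso.inv_hom_id, T.map_id, Category.id_comp]

/-! ### Extension of complexes by zero commutes with additive functors -/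

section MapExtend

variable {ι ι' : Type*} {c : ComplexShape ι} {d : ComplexShape ι'}
  {C D : Type*} [Category* C] [Category* D] [Preadditive C] [Preadditive D]
  [HasZeroObject C] [HasZeroObject D]
  (F : C ⥤ D) [F.Additive] (K : HomologicalComplex C c) (e : c.Embedding d)

/-- The components of the comparison between extending by zero before and after applying `F`. -/
def extendMapFunctorX : ∀ o : Option ι,
    HomologicalComplex.extend.X ((F.mapHomologicalComplex c).obj K) o ⟶
      F.obj (HomologicalComplex.extend.X K o)
  | some i => 𝟙 (F.obj (K.X i))
  | none => 0

theorem extendMapFunctorX_some {o : Option ι} {i : ι} (h : o = some i) :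
    extendMapFunctorX F K o =
      (HomologicalComplex.extend.XIso ((F.mapHomologicalComplex c).obj K) h).hom ≫
        F.map (HomologicalComplex.extend.XIso K h).inv := by
  subst h
  change 𝟙 (F.obj (K.X i)) = 𝟙 _ ≫ F.map (𝟙 _)
  rw [F.map_id, Category.id_comp]

/-- The comparison between extending a complex by zero before and after applying `F`. -/
def extendMapFunctor :
    ((F.mapHomologicalComplex c).obj K).extend e ⟶
      (F.mapHomologicalComplex d).obj (K.extend e) where
  f i' := extendMapFunctorX F K (e.r i')
  comm' i' j' _ := by
    obtain hi' | ⟨i, hi⟩ := (e.r i').eq_none_or_eq_some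
    · exact (HomologicalComplex.isZero_extend_X' _ e i' hi').eq_of_src _ _
    · obtain hj' | ⟨j, hj⟩ := (e.r j').eq_none_or_eq_some
      · exact (F.map_isZero (HomologicalComplex.isZero_extend_X' K e j' hj')).eq_of_tgt _ _
      · have hi' := e.f_eq_of_r_eq_some hi
        have hj' := e.f_eq_of_r_eq_some hj
        rw [Functor.mapHomologicalComplex_obj_d, HomologicalComplex.extend_d_eq _ e hi' hj',
          HomologicalComplex.extend_d_eq _ e hi' hj', extendMapFunctorX_some F K hi,
          extendMapFunctorX_some F K hj]
        exact map_conj_comm F (HomologicalComplex.extend.XIso ((F.mapHomologicalComplex c).obj K) hi)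
          (HomologicalComplex.extend.XIso ((F.mapHomologicalComplex c).obj K) hj)
          (HomologicalComplex.extend.XIso K hi) (HomologicalComplex.extend.XIso K hj) (K.d i j)

theorem extendMapFunctor_f {i : ι} {i' : ι'} (h : e.f i = i') :
    (extendMapFunctor F K e).f i' =
      (((F.mapHomologicalComplex c).obj K).extendXIso e h).hom ≫
        F.map (K.extendXIso e h).inv :=
  extendMapFunctorX_some F K (e.r_eq_some h)

end MapExtend

/-! ### Exact functors on Ext classes given by cocycles -/

section MapExtMk

open CochainComplex HomComplex

variable {C D : Type*} [Category.{v} C] [Category.{w} D] [Abelian C] [Abelian D]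
  (F : C ⥤ D) [F.Additive] [PreservesFiniteLimits F] [PreservesFiniteColimits F]
  [F.PreservesProjectiveObjects] {X Y : C} (R : ProjectiveResolution X)

/-- The cochain complex of the image of a projective resolution. -/
def mapCochainComplex :
    (F.mapProjectiveResolution R).cochainComplex ⟶
      (F.mapHomologicalComplex (.up ℤ)).obj R.cochainComplex :=
  extendMapFunctor F R.complex ComplexShape.embeddingDownNat

theorem mapCochainComplex_f (n : ℤ) (k : ℕ) (h : -k = n) :
    (mapCochainComplex F R).f n =
      ((F.mapProjectiveResolution R).cochainComplexXIso n k h).hom ≫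
        F.map (R.cochainComplexXIso n k h).inv :=
  extendMapFunctor_f F R.complex ComplexShape.embeddingDownNat h

/-- The target is concentrated in degree 0, so the two maps need only be compared there, where both
are the image of the augmentation up to canonical isomorphisms. -/
theorem mapCochainComplex_comp_π' :
    mapCochainComplex F R ≫ (F.mapHomologicalComplex (.up ℤ)).map R.π' =
      (F.mapProjectiveResolution R).π' ≫ (F.mapCochainComplexSingleFunctor 0).inv.app X := by
  rw [← cancel_mono ((F.mapCochainComplexSingleFunctor 0).hom.app X), Category.assoc,
    Category.assoc, Iso.inv_hom_id_app]
  refine HomologicalComplex.to_single_hom_ext ?_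
  rw [HomologicalComplex.comp_f, HomologicalComplex.comp_f, mapCochainComplex_f F R 0 0 (by simp),
      Functor.mapHomologicalComplex_map_f,
      ProjectiveResolution.π'_f_zero]
  have h1 : ((F.mapCochainComplexSingleFunctor 0).hom.app X).f 0 =
    F.map (HomologicalComplex.singleObjXSelf (.up ℤ) 0 X).hom ≫
      (HomologicalComplex.singleObjXSelf (.up ℤ) 0 (F.obj X)).inv :=
    HomologicalComplex.singleMapHomologicalComplex_hom_app_self F (.up ℤ) 0 X
  have h2 : (F.mapProjectiveResolution R).π.f 0 = F.map (R.π.f 0) ≫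
      F.map (HomologicalComplex.singleObjXSelf (.down ℕ) 0 X).hom ≫
      (HomologicalComplex.singleObjXSelf (.down ℕ) 0 (F.obj X)).inv := by
    rw [Functor.mapProjectiveResolution_π, HomologicalComplex.comp_f,
      HomologicalComplex.singleMapHomologicalComplex_hom_app_self F (.down ℕ) 0 X]
    rfl
  have h4 : ((F.mapProjectiveResolution R).π' ≫ 𝟙 ((F ⋙ singleFunctor D 0).obj X)).f 0 =
      (F.mapProjectiveResolution R).π'.f 0 := 
    congrArg (fun φ : (F.mapProjectiveResolution R).cochainComplex ⟶
      (singleFunctor D 0).obj (F.obj X) => φ.f 0) (Category.comp_id _)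
  rw [h1]
  refine Eq.trans ?_ h4.symm
  rw [ProjectiveResolution.π'_f_zero]
  refine (map_conj_augmentation F
    (((F.mapProjectiveResolution R).cochainComplexXIso 0 0 (by simp)).hom)
    (HomologicalComplex.singleObjXSelf (.up ℤ) 0 (F.obj X))
    (R.cochainComplexXIso 0 0 (by simp))
    (HomologicalComplex.singleObjXSelf (.up ℤ) 0 X) (R.π.f 0)).trans ?_
  have h3 : (F.mapProjectiveResolution R).π.f 0 = F.map (R.π.f 0) := by
    rw [h2]
    exact map_comp_map_id_comp_id F (R.π.f 0 : R.complex.X 0 ⟶ X)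
  rw [h3]
  rfl

theorem equivHomShift_map_v {K L : CochainComplex C ℤ} {n : ℤ} (c : K ⟶ L⟦n⟧) (p q : ℤ)
    (h : p + n = q) :
    (Cocycle.equivHomShift (ShiftedHom.map c (F.mapHomologicalComplex (.up ℤ)))).1.v p q h =
      F.map ((Cocycle.equivHomShift c).1.v p q h) := by
  subst h
  rw [Cocycle.equivHomShift_apply, Cocycle.equivHomShift_apply]
  simp [Cochain.rightUnshift_v _ _ _ _ _ _ _ (add_zero p), ShiftedHom.map]
  exact (Category.comp_id _).trans (congrArg F.map (Category.comp_id _)).symm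

/-- A cocycle with values in a single complex is determined by one component, here the one in degree
-n, and on both sides this component is `F.map f` up to canonical isomorphisms. -/
theorem mapCochainComplex_comp_cocycle {n : ℕ} (f : R.complex.X n ⟶ Y) (m : ℕ)
    (h1 h2 h3 h4 h5 h6) :
    mapCochainComplex F R ≫ ShiftedHom.map (Cocycle.equivHomShift.symm
          (Cocycle.toSingleMk (q := 0) (n := n) ((R.cochainComplexXIso (-n) n rfl).hom ≫ f) h1 (-m)
            h2 h3)) (F.mapHomologicalComplex (.up ℤ)) ≫
        ((F.mapCochainComplexSingleFunctor 0).hom.app Y)⟦(n : ℤ)⟧' =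
      Cocycle.equivHomShift.symm (Cocycle.toSingleMk (q := 0) (n := n)
        (((F.mapProjectiveResolution R).cochainComplexXIso (-n) n rfl).hom ≫ F.map f) h4 (-m)
            h5 h6) := by
  apply Cocycle.equivHomShift.injective
  rw [AddEquiv.apply_symm_apply, Cocycle.equivHomShift_comp, Cocycle.equivHomShift_comp_shift]
  ext : 1
  apply (Cochain.toSingleEquiv h4).injective
  rw [Cocycle.toSingleMk_coe, Cochain.toSingleEquiv_toSingleMk]
  change (Cochain.v _ (-n) 0 h4) ≫ _ = _
  rw [Cocycle.precomp_coe, Cocycle.postcomp_coe, Cochain.zero_cochain_comp_v,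
    Cochain.comp_zero_cochain_v, Cochain.ofHom_v, Cochain.ofHom_v, equivHomShift_map_v,
    AddEquiv.apply_symm_apply, Cocycle.toSingleMk_coe, Cochain.toSingleMk_v]
  have h1 : ((F.mapCochainComplexSingleFunctor 0).hom.app Y).f 0 =
    F.map (HomologicalComplex.singleObjXSelf (.up ℤ) 0 Y).hom ≫
      (HomologicalComplex.singleObjXSelf (.up ℤ) 0 (F.obj Y)).inv :=
    HomologicalComplex.singleMapHomologicalComplex_hom_app_self F (.up ℤ) 0 Y
  rw [h1, mapCochainComplex_f F R (-n) n rfl]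
  exact map_conj_cocycle F ((F.mapProjectiveResolution R).cochainComplexXIso (-n) n rfl).hom
    (HomologicalComplex.singleObjXSelf (.up ℤ) 0 (F.obj Y)) (R.cochainComplexXIso (-n) n rfl)
    (HomologicalComplex.singleObjXSelf (.up ℤ) 0 Y) f

section Derived

attribute [local instance] HasDerivedCategory.standard

theorem map_map_Q {K L : CochainComplex C ℤ} {n : ℤ} (c : ShiftedHom K L n) :
    (c.map DerivedCategory.Q).map F.mapDerivedCategory =
      F.mapDerivedCategoryFactors.hom.app K ≫
        ((c.map (F.mapHomologicalComplex (.up ℤ))).map DerivedCategory.Q) ≫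
          (F.mapDerivedCategoryFactors.inv.app L)⟦n⟧' := by
  rw [← ShiftedHom.comp_map, ← ShiftedHom.comp_map,
    ← ShiftedHom.map_naturality_2 c F.mapDerivedCategoryFactors,
    ShiftedHom.mk₀_comp, ShiftedHom.comp_mk₀]

theorem map_Q_conj {K K' L L' : CochainComplex D ℤ} {n : ℤ} (φ : K' ⟶ K) (c : ShiftedHom K L n)
    (s : L ⟶ L') :
    ShiftedHom.map (φ ≫ c ≫ s⟦n⟧' : ShiftedHom K' L' n) DerivedCategory.Q =
      DerivedCategory.Q.map φ ≫ c.map DerivedCategory.Q ≫ (DerivedCategory.Q.map s)⟦n⟧' := by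
  rw [← ShiftedHom.comp_mk₀ _ 0 rfl, ← ShiftedHom.mk₀_comp 0 rfl, ShiftedHom.map_comp,
    ShiftedHom.map_comp, ShiftedHom.map_mk₀, ShiftedHom.map_mk₀, ShiftedHom.comp_mk₀,
    ShiftedHom.mk₀_comp]

/-- The source square for `mapExactFunctor_extMk`: it compares the formal inverses of the
augmentations of `R` and of its image. The target square is `single_comp_factors`. -/
theorem single_comp_inv_π' :
    (F.mapDerivedCategorySingleFunctor 0).inv.app X ≫
      F.mapDerivedCategory.map ((DerivedCategory.singleFunctorIsoCompQ C 0).hom.app X ≫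
        inv (DerivedCategory.Q.map R.π')) ≫ F.mapDerivedCategoryFactors.hom.app _ =
    ((DerivedCategory.singleFunctorIsoCompQ D 0).hom.app (F.obj X) ≫
        inv (DerivedCategory.Q.map (F.mapProjectiveResolution R).π')) ≫
      DerivedCategory.Q.map (mapCochainComplex F R) := by
  have : IsIso (DerivedCategory.Q.map ((F.mapHomologicalComplex (.up ℤ)).map R.π')) :=
    inferInstance
  have : Mono ((F.mapHomologicalComplex (.up ℤ) ⋙ DerivedCategory.Q).map R.π') :=
    inferInstanceAs (Mono (DerivedCategory.Q.map ((F.mapHomologicalComplex (.up ℤ)).map R.π')))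
  have hP : IsIso (DerivedCategory.Q.map (F.mapProjectiveResolution R).π') := inferInstance
  exact comp_map_inv_comp (hP := hP)
    DerivedCategory.Q F.mapDerivedCategory
    (F.mapHomologicalComplex (.up ℤ) ⋙ DerivedCategory.Q) F.mapDerivedCategoryFactors.hom R.π'
    (Functor.mapDerivedCategorySingleFunctor_inv_app_mapDerivedCategoryFactors_hom_app F X)
    ((DerivedCategory.Q.map_comp _ _).symm.trans
      ((congrArg DerivedCategory.Q.map (mapCochainComplex_comp_π' F R)).trans
        (DerivedCategory.Q.map_comp _ _)))

theorem single_comp_factors (Y : C) :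
    F.mapDerivedCategoryFactors.inv.app _ ≫
      F.mapDerivedCategory.map ((DerivedCategory.singleFunctorIsoCompQ C 0).inv.app Y) ≫ 
        (F.mapDerivedCategorySingleFunctor 0).hom.app Y =
    DerivedCategory.Q.map ((F.mapCochainComplexSingleFunctor 0).hom.app Y) ≫ 
      (DerivedCategory.singleFunctorIsoCompQ D 0).inv.app (F.obj Y) := by
  exact comp_map_id_comp F.mapDerivedCategory
    (Functor.mapDerivedCategoryFactors_inv_app_mapDerivedCategorySingleFunctor_hom_app F Y)

variable [HasExt.{u} C] [HasExt.{u} D]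

/-- In the derived category the class of `f` is the zigzag X ← R → Y[n]. Each leg is compatible with
F through the comparison `mapCochainComplex`, so the image zigzag is the one built from the image
resolution and `F.map f`. -/
theorem mapExactFunctor_extMk {n : ℕ} (f : R.complex.X n ⟶ Y) (m : ℕ) (hm : n + 1 = m)
    (hf : R.complex.d m n ≫ f = 0)
    (hf' : (F.mapProjectiveResolution R).complex.d m n ≫ F.map f = 0) :
    (R.extMk f m hm hf).mapExactFunctor F =
      (F.mapProjectiveResolution R).extMk (F.map f) m hm hf' := by
  ext
  refine Eq.trans ?_ (ProjectiveResolution.extMk_hom _ _ _ _ _).symm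
  rw [Ext.mapExactFunctor_hom, ProjectiveResolution.extMk_hom]
  rw [← mapCochainComplex_comp_cocycle F R f m (by simp) (by lia)
    (by simpa [R.cochainComplex_d _ _ _ _ rfl rfl])]
  generalize Cocycle.equivHomShift.symm
          (Cocycle.toSingleMk (q := 0) (n := n) ((R.cochainComplexXIso (-n) n rfl).hom ≫ f)
            _ (-m) _ _) = c
  refine Eq.trans ?_ (congrArg (fun t => ShiftedHom.comp _ (ShiftedHom.comp t _ _) _)
    (map_Q_conj _ _ _).symm)
  rw [ShiftedHom.map_comp, ShiftedHom.map_comp, ShiftedHom.map_mk₀, ShiftedHom.map_mk₀, map_map_Q]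
  rw [ShiftedHom.mk₀_comp, ShiftedHom.mk₀_comp, ShiftedHom.comp_mk₀, ShiftedHom.comp_mk₀]
  exact comp_shift_conj (CategoryTheory.shiftFunctor (DerivedCategory D) (n : ℤ))
    (single_comp_inv_π' F R) (single_comp_factors F Y)

end Derived

end MapExtMk

/-! ### Modules over the smash product and graded modules -/

section Graded

variable {K : Type*} [Field K] {G : Type*} [AddGroup G] [Fintype G] [DecidableEq G]
  {A : Type*} [Ring A] [Algebra K A] (𝒜 : G → Submodule K A) [GradedAlgebra 𝒜]

/-! ### Generators of the smash product -/

/-- The embedding `a ↦ ∑ g, a # p_g` of `A` into `A # G^*`. -/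
def Smash.const : A →+* Smash 𝒜 where
  toFun a := fun _ => a
  map_one' := rfl
  map_zero' := rfl
  map_add' _ _ := rfl
  map_mul' a b := by
    refine funext fun h => Eq.symm ((Smash.mul_apply 𝒜 _ _ h).trans ?_)
    rw [← Finset.mul_sum, sum_proj_sub]

theorem Smash.const_apply (a : A) (h : G) : Smash.const 𝒜 a h = a := rfl

/-- The idempotent `1 # p_g`. -/
def Smash.idem (g : G) : Smash 𝒜 := Smash.single 𝒜 1 g

theorem Smash.single_apply (a : A) (g h : G) :
    Smash.single 𝒜 a g h = if h = g then a else 0 := by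
  by_cases hg : h = g
  · subst hg
    simp [Smash.single]
  · simp [Smash.single, hg]

theorem Smash.const_mul_single (a b : A) (g : G) :
    Smash.const 𝒜 a * Smash.single 𝒜 b g = Smash.single 𝒜 (a * b) g := by
  funext h
  rw [Smash.mul_apply]
  simp only [Smash.const_apply]
  rw [← Finset.mul_sum, sum_proj_sub, Smash.single_apply, Smash.single_apply]
  split_ifs <;> simp

theorem Smash.const_mul_idem (a : A) (g : G) :
    Smash.const 𝒜 a * Smash.idem 𝒜 g = Smash.single 𝒜 a g := by
  rw [Smash.idem, Smash.const_mul_single, mul_one]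

theorem Smash.sum_apply {ι : Type*} (s : Finset ι) (f : ι → Smash 𝒜) (h : G) :
    (∑ i ∈ s, f i) h = ∑ i ∈ s, f i h :=
  Finset.sum_apply h s f

theorem Smash.sum_single (x : Smash 𝒜) : ∑ g, Smash.single 𝒜 (x g) g = x := by
  funext h
  simp only [Smash.sum_apply, Smash.single_apply]
  exact Fintype.sum_ite_eq h x

theorem Smash.sum_idem : ∑ g, Smash.idem 𝒜 g = 1 :=
  Smash.sum_single 𝒜 1

theorem Smash.idem_mul_single (g h : G) (a : A) :
    Smash.idem 𝒜 g * Smash.single 𝒜 a h = Smash.single 𝒜 (GradedRing.proj 𝒜 (g - h) a) h := by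
  rw [Smash.idem, Smash.single_mul_single, one_mul]

theorem Smash.idem_mul_idem (g h : G) :
    Smash.idem 𝒜 g * Smash.idem 𝒜 h = if g = h then Smash.idem 𝒜 g else 0 := by
  conv_lhs => rw [Smash.idem, Smash.idem, Smash.single_mul_single, proj_sub_one]
  split_ifs with hgh
  · rw [hgh, one_mul, Smash.idem]
  · rw [mul_zero]
    exact Pi.single_zero h

/-- The commutation rule between the idempotents and `A`. Together with orthogonality of the
idempotents it governs all computations in the smash product, and it is the axiom `proj_smul` of
`GradedProjections`. -/
theorem Smash.idem_mul_const (g : G) (a : A) :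
    Smash.idem 𝒜 g * Smash.const 𝒜 a =
      ∑ h, Smash.const 𝒜 (GradedRing.proj 𝒜 (g - h) a) * Smash.idem 𝒜 h := by
  rw [← mul_one (Smash.const 𝒜 a), ← Smash.sum_idem, Finset.mul_sum, Finset.mul_sum]
  refine Finset.sum_congr rfl fun h _ => ?_
  rw [Smash.const_mul_idem, Smash.const_mul_idem, Smash.idem_mul_single]

theorem proj_proj (g h : G) (a : A) :
    GradedRing.proj 𝒜 g (GradedRing.proj 𝒜 h a) = if g = h then GradedRing.proj 𝒜 g a else 0 := by
  simp only [GradedRing.proj_apply]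
  split_ifs with hgh
  · subst hgh
    exact DirectSum.decompose_of_mem_same 𝒜 (SetLike.coe_mem _)
  · exact DirectSum.decompose_of_mem_ne 𝒜 (SetLike.coe_mem _) (Ne.symm hgh)

theorem Smash.idem_mul_const_proj (g h : G) (a : A) :
    Smash.idem 𝒜 g * Smash.const 𝒜 (GradedRing.proj 𝒜 (g - h) a) =
      Smash.const 𝒜 (GradedRing.proj 𝒜 (g - h) a) * Smash.idem 𝒜 h := by
  rw [Smash.idem_mul_const, Finset.sum_eq_single h, proj_proj, if_pos rfl]
  · intro l _ hl
    rw [proj_proj, if_neg (fun h' => hl (sub_right_injective h')), map_zero, zero_mul]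
  · simp

theorem Smash.sum_const_proj_mul (a : A) (h : G) :
    ∑ g, Smash.const 𝒜 (GradedRing.proj 𝒜 (g - h) a) = Smash.const 𝒜 a := by
  rw [← map_sum, sum_proj_sub]

/-! ### Linear maps between modules over the smash product -/

section Average

variable {M N : Type*} [AddCommGroup M] [AddCommGroup N] [Module (Smash 𝒜) M] [Module (Smash 𝒜) N]

theorem Smash.smul_eq_sum (x : Smash 𝒜) (m : M) :
    x • m = ∑ g, Smash.const 𝒜 (x g) • Smash.idem 𝒜 g • m := by
  conv_lhs => rw [← Smash.sum_single 𝒜 x, Finset.sum_smul]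
  refine Finset.sum_congr rfl fun g _ => ?_
  rw [← Smash.const_mul_idem, mul_smul]

theorem Smash.sum_idem_smul (m : M) : ∑ g, Smash.idem 𝒜 g • m = m := by
  rw [← Finset.sum_smul, Smash.sum_idem, one_smul]

theorem Smash.idem_smul_idem_smul (g h : G) (m : M) :
    Smash.idem 𝒜 g • Smash.idem 𝒜 h • m = if g = h then Smash.idem 𝒜 g • m else 0 := by
  rw [← mul_smul, Smash.idem_mul_idem]
  split_ifs
  · rfl
  · rw [zero_smul]

/-- An additive map that commutes with `A` and with the idempotents `p_g` is linear. -/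
def Smash.mkLinear (f : M →+ N) (h₁ : ∀ a m, f (Smash.const 𝒜 a • m) = Smash.const 𝒜 a • f m)
    (h₂ : ∀ g m, f (Smash.idem 𝒜 g • m) = Smash.idem 𝒜 g • f m) : M →ₗ[Smash 𝒜] N where
  __ := f
  map_smul' x m := by
    change f (x • m) = x • f m
    rw [Smash.smul_eq_sum 𝒜 x m, Smash.smul_eq_sum 𝒜 x (f m), map_sum]
    simp only [h₁, h₂]

/-- The part of degree zero of an `A`-linear map. -/
def Smash.average (f : M →+ N) (hf : ∀ a m, f (Smash.const 𝒜 a • m) = Smash.const 𝒜 a • f m) :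
    M →ₗ[Smash 𝒜] N :=
  Smash.mkLinear 𝒜
    (∑ g, (DistribSMul.toAddMonoidHom N (Smash.idem 𝒜 g)).comp
      (f.comp (DistribSMul.toAddMonoidHom M (Smash.idem 𝒜 g))))
    (fun a m => by
      simp only [AddMonoidHom.finsetSum_apply, AddMonoidHom.comp_apply,
        DistribSMul.toAddMonoidHom_apply, Finset.smul_sum]
      -- Moving p_g through `a` inside `f` produces the terms a_{g-h} p_h. Since a_{g-h} has degree
      -- g - h, the outer p_g then passes it and becomes p_h, so the sum over g reassembles `a`.
      have key : ∀ g, Smash.idem 𝒜 g • f (Smash.idem 𝒜 g • Smash.const 𝒜 a • m) =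
          ∑ h, Smash.const 𝒜 (GradedRing.proj 𝒜 (g - h) a) • Smash.idem 𝒜 h •
            f (Smash.idem 𝒜 h • m) := fun g => by
        rw [← mul_smul, Smash.idem_mul_const, Finset.sum_smul, map_sum, Finset.smul_sum]
        refine Finset.sum_congr rfl fun h _ => ?_
        rw [mul_smul, hf, ← mul_smul, Smash.idem_mul_const_proj, mul_smul]
      simp only [key]
      rw [Finset.sum_comm]
      refine Finset.sum_congr rfl fun h _ => ?_
      rw [← Finset.sum_smul, Smash.sum_const_proj_mul])
    (fun g m => by
      simp only [AddMonoidHom.finsetSum_apply, AddMonoidHom.comp_apply,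
        DistribSMul.toAddMonoidHom_apply, Finset.smul_sum, Smash.idem_smul_idem_smul]
      rw [Finset.sum_eq_single g, Finset.sum_eq_single g]
      · simp
      · intro h _ hh
        rw [if_neg (Ne.symm hh)]
      · simp
      · intro h _ hh
        rw [if_neg hh, map_zero, smul_zero]
      · simp)

theorem Smash.average_apply (f : M →+ N)
    (hf : ∀ a m, f (Smash.const 𝒜 a • m) = Smash.const 𝒜 a • f m) (m : M) :
    Smash.average 𝒜 f hf m = ∑ g, Smash.idem 𝒜 g • f (Smash.idem 𝒜 g • m) := by
  change (∑ g, (DistribSMul.toAddMonoidHom N (Smash.idem 𝒜 g)).comp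
      (f.comp (DistribSMul.toAddMonoidHom M (Smash.idem 𝒜 g)))) m = _
  simp

end Average

/-! ### Gradings as families of projections -/

/-- A grading of an `A`-module by `G`, given by the projections to the components. -/
structure GradedProjections (M : Type*) [AddCommGroup M] [Module A M] where
  /-- the projection to the component of degree `g` -/
  proj : G → M →+ M
  proj_proj : ∀ g h m, proj g (proj h m) = if g = h then proj g m else 0
  sum_proj : ∀ m, ∑ g, proj g m = m
  proj_smul : ∀ g (a : A) m, proj g (a • m) = ∑ h, GradedRing.proj 𝒜 (g - h) a • proj h m

namespace GradedProjections

variable {𝒜} {M : Type*} [AddCommGroup M] [Module A M]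

theorem sum_proj_sub (p : GradedProjections 𝒜 M) (h : G) (m : M) :
    ∑ g, p.proj (g - h) m = m := by
  rw [Fintype.sum_equiv (Equiv.subRight h) (fun g => p.proj (g - h) m) (fun g => p.proj g m)
    (fun _ => rfl), p.sum_proj]

/-- The shifted grading: the component of degree `g` is the former one of degree `g - h`. -/
def shift (p : GradedProjections 𝒜 M) (h : G) : GradedProjections 𝒜 M where
  proj g := p.proj (g - h)
  proj_proj g k m := by
    rw [p.proj_proj]
    simp only [sub_left_inj]
  sum_proj := p.sum_proj_sub h
  proj_smul g a m := by
    rw [p.proj_smul, ← Fintype.sum_equiv (Equiv.subRight h)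
      (fun k => GradedRing.proj 𝒜 (g - k) a • p.proj (k - h) m)]
    intro k
    simp only [Equiv.subRight_apply, sub_sub_sub_cancel_right]

/-- The component of degree `g`. -/
def component (p : GradedProjections 𝒜 M) (g : G) : AddSubgroup M :=
  (p.proj g - AddMonoidHom.id M).ker

theorem mem_component (p : GradedProjections 𝒜 M) (g : G) (m : M) :
    m ∈ p.component g ↔ p.proj g m = m := by
  rw [component, AddMonoidHom.mem_ker, AddMonoidHom.sub_apply, sub_eq_zero, AddMonoidHom.id_apply]

theorem proj_mem (p : GradedProjections 𝒜 M) (g : G) (m : M) : p.proj g m ∈ p.component g := by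
  rw [mem_component, p.proj_proj, if_pos rfl]

theorem proj_of_mem (p : GradedProjections 𝒜 M) {g h : G} {m : M} (hm : m ∈ p.component h) :
    p.proj g m = if g = h then m else 0 := by
  rw [← (p.mem_component h m).1 hm, p.proj_proj]
  split_ifs with hgh
  · rw [hgh]
  · rfl

/-- The module over the smash product that corresponds to a graded module. -/
def Mod (_p : GradedProjections 𝒜 M) : Type _ := M

variable (p : GradedProjections 𝒜 M)

instance : AddCommGroup p.Mod := inferInstanceAs (AddCommGroup M)

/-- The identity map from `M` to the corresponding module over the smash product. -/
def toMod : M ≃+ p.Mod := AddEquiv.refl M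

/-- The action of the smash product on a graded module. -/
def act (x : Smash 𝒜) : M →+ M := ∑ g, (DistribSMul.toAddMonoidHom M (x g)).comp (p.proj g)

theorem act_apply (x : Smash 𝒜) (m : M) : p.act x m = ∑ g, x g • p.proj g m := by
  simp [act]

/-- The projections satisfy the same commutation and orthogonality relations as the idempotents p_g,
which is exactly what associativity of the action requires. -/
theorem act_mul (x y : Smash 𝒜) (m : M) : p.act (x * y) m = p.act x (p.act y m) := by
  simp only [act_apply, Smash.mul_apply, map_sum, p.proj_smul, Finset.sum_smul, p.proj_proj,
    Finset.smul_sum]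
  refine Finset.sum_congr rfl fun h _ => Finset.sum_congr rfl fun g _ => ?_
  rw [Finset.sum_eq_single h]
  · rw [if_pos rfl, mul_smul]
  · intro k _ hk
    rw [if_neg hk, smul_zero, smul_zero]
  · simp

instance : Module (Smash 𝒜) p.Mod where
  smul x m := p.toMod (p.act x (p.toMod.symm m))
  one_smul m := by
    change p.toMod (p.act 1 (p.toMod.symm m)) = m
    rw [act_apply]
    simp only [Smash.one_apply, one_smul, p.sum_proj, AddEquiv.apply_symm_apply]
  mul_smul x y m := p.act_mul x y m
  smul_zero x := (p.act x).map_zero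
  zero_smul m := by
    change p.toMod (p.act 0 (p.toMod.symm m)) = 0
    rw [act_apply]
    simp only [Smash.zero_apply, zero_smul, Finset.sum_const_zero, map_zero]
  smul_add x := (p.act x).map_add
  add_smul x y m := by
    change p.toMod (p.act (x + y) (p.toMod.symm m)) =
      p.toMod (p.act x (p.toMod.symm m)) + p.toMod (p.act y (p.toMod.symm m))
    simp only [act_apply, Smash.add_apply, add_smul, Finset.sum_add_distrib, map_add]

theorem smul_toMod (x : Smash 𝒜) (m : M) : x • p.toMod m = p.toMod (∑ g, x g • p.proj g m) :=
  congrArg p.toMod (p.act_apply x m)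

theorem const_smul_toMod (a : A) (m : M) : Smash.const 𝒜 a • p.toMod m = p.toMod (a • m) := by
  rw [smul_toMod]
  simp only [Smash.const_apply]
  rw [← Finset.smul_sum, p.sum_proj]

theorem idem_smul_toMod (g : G) (m : M) :
    Smash.idem 𝒜 g • p.toMod m = p.toMod (p.proj g m) := by
  rw [smul_toMod, Finset.sum_eq_single g]
  · rw [Smash.idem, Smash.single_apply, if_pos rfl, one_smul]
  · intro h _ hh
    rw [Smash.idem, Smash.single_apply, if_neg hh, zero_smul]
  · simp

end GradedProjections

end Graded

/-! ### The functor that forgets the grading -/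

section Forget

variable {K : Type*} [Field K] {G : Type u} [AddGroup G] [Fintype G] [DecidableEq G]
  {A : Type u} [Ring A] [Algebra K A] (𝒜 : G → Submodule K A) [GradedAlgebra 𝒜]

/-- The functor that forgets the grading. -/
abbrev forgetGrading : ModuleCat.{u} (Smash 𝒜) ⥤ ModuleCat.{u} A :=
  ModuleCat.restrictScalars (Smash.const 𝒜)

theorem Smash.const_algebraMap (r : K) :
    Smash.const 𝒜 (algebraMap K A r) = algebraMap K (Smash 𝒜) r := by
  funext h
  rw [Smash.const_apply, Algebra.algebraMap_eq_smul_one, Algebra.algebraMap_eq_smul_one,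
    Smash.smul_apply, Smash.one_apply]

instance : (forgetGrading 𝒜).Linear K where
  map_smul {M N} f r := by
    ext m
    change algebraMap K (Smash 𝒜) r • f.hom m = Smash.const 𝒜 (algebraMap K A r) • f.hom m
    rw [Smash.const_algebraMap]

/-- Through `Smash.const`, the smash product is a free `A`-module of rank |G|. Hence a direct
summand of a free module over it is a direct summand of a projective `A`-module. -/
theorem projective_of_projective_smash (M : Type*) [AddCommGroup M] [Module (Smash 𝒜) M]
    [Module A M] (h : ∀ (a : A) (m : M), a • m = Smash.const 𝒜 a • m)
    (hM : Module.Projective (Smash 𝒜) M) : Module.Projective A M := by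
  let : Module A (Smash 𝒜) := Module.compHom _ (Smash.const 𝒜)
  let e : (G → A) ≃ₗ[A] Smash 𝒜 :=
    { AddEquiv.refl (G → A) with
      map_smul' := fun a x => by
        refine funext fun g => Eq.symm ?_
        refine (Smash.mul_apply 𝒜 (Smash.const 𝒜 a) x g).trans ?_
        simp only [Smash.const_apply]
        rw [← Finset.mul_sum, sum_proj_sub]
        rfl }
  have : Module.Projective A (Smash 𝒜) := Module.Projective.of_equiv e
  have : IsScalarTower A (Smash 𝒜) (Smash 𝒜) := ⟨fun a x y => mul_assoc (Smash.const 𝒜 a) x y⟩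
  have : IsScalarTower A (Smash 𝒜) M := ⟨fun a x m => by
    rw [h]
    exact mul_smul (Smash.const 𝒜 a) x m⟩
  classical
  have : Module.Projective A (M →₀ Smash 𝒜) :=
    Module.Projective.of_equiv (finsuppLEquivDirectSum A (Smash 𝒜) M).symm
  obtain ⟨s, hs⟩ := (Module.projective_def' (R := Smash 𝒜) (P := M)).1 hM
  refine Module.Projective.of_split (s.restrictScalars A)
    ((Finsupp.linearCombination (Smash 𝒜) id).restrictScalars A) ?_
  ext m
  exact LinearMap.congr_fun hs m

instance : (forgetGrading 𝒜).PreservesProjectiveObjects where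
  projective_obj {P} hP := by
    let : Module A P := Module.compHom P (Smash.const 𝒜)
    have h := projective_of_projective_smash 𝒜 P (fun a m => rfl)
      ((IsProjective.iff_projective _).2 hP)
    exact (IsProjective.iff_projective (R := A) (P := P)).1 h

end Forget

/-! ### Homogeneous parts of linear maps -/

section Parts

variable {K : Type*} [Field K] {G : Type u} [AddGroup G] [Fintype G] [DecidableEq G]
  {A : Type u} [Ring A] [Algebra K A] {𝒜 : G → Submodule K A} [GradedAlgebra 𝒜]

/-- The additive map underlying a linear map out of a module with forgotten grading. -/
def underlying {N : ModuleCat.{u} (Smash 𝒜)} {X : ModuleCat.{u} A}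
    (f : (forgetGrading 𝒜).obj N ⟶ X) : N →+ X :=
  f.hom.toAddMonoidHom

theorem underlying_smul {N : ModuleCat.{u} (Smash 𝒜)} {X : ModuleCat.{u} A}
    (f : (forgetGrading 𝒜).obj N ⟶ X) (a : A) (n : N) :
    underlying f (Smash.const 𝒜 a • n) = a • underlying f n :=
  f.hom.map_smul a n

theorem underlying_ext {N : ModuleCat.{u} (Smash 𝒜)} {X : ModuleCat.{u} A}
    {f g : (forgetGrading 𝒜).obj N ⟶ X} (h : ∀ n : N, underlying f n = underlying g n) : f = g :=
  ModuleCat.hom_ext (LinearMap.ext h)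

/-- Linear maps out of a module with forgotten grading as additive maps. -/
def mkUnderlying {N : ModuleCat.{u} (Smash 𝒜)} {X : ModuleCat.{u} A} (f : N →+ X)
    (h : ∀ (a : A) (n : N), f (Smash.const 𝒜 a • n) = a • f n) : (forgetGrading 𝒜).obj N ⟶ X :=
  ModuleCat.ofHom (X := (forgetGrading 𝒜).obj N) { f with map_smul' := h }

theorem underlying_map_comp {M N : ModuleCat.{u} (Smash 𝒜)} {X : ModuleCat.{u} A} (g : M ⟶ N)
    (f : (forgetGrading 𝒜).obj N ⟶ X) (m : M) :
    underlying ((forgetGrading 𝒜).map g ≫ f) m = underlying f (g.hom m) :=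
  rfl

theorem underlying_sum {N : ModuleCat.{u} (Smash 𝒜)} {X : ModuleCat.{u} A} {ι : Type*}
    (s : Finset ι) (f : ι → ((forgetGrading 𝒜).obj N ⟶ X)) (n : N) :
    underlying (∑ i ∈ s, f i) n = ∑ i ∈ s, underlying (f i) n := by
  classical
  induction s using Finset.induction_on with
  | empty => rw [Finset.sum_empty, Finset.sum_empty]; rfl
  | insert i s hi ih => rw [Finset.sum_insert hi, Finset.sum_insert hi, ← ih]; rfl

/-- The additive map underlying a linear map between modules with forgotten gradings. -/
def underlying₂ {M N : ModuleCat.{u} (Smash 𝒜)}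
    (f : (forgetGrading 𝒜).obj M ⟶ (forgetGrading 𝒜).obj N) : M →+ N :=
  underlying f

theorem underlying₂_smul {M N : ModuleCat.{u} (Smash 𝒜)}
    (f : (forgetGrading 𝒜).obj M ⟶ (forgetGrading 𝒜).obj N) (a : A) (m : M) :
    underlying₂ f (Smash.const 𝒜 a • m) = Smash.const 𝒜 a • underlying₂ f m :=
  f.hom.map_smul a m

/-- A lift found over `A` need not preserve degrees, but its part of degree zero does. It is still a
lift, because the maps `e` and `f` commute with the idempotents. -/
theorem projective_of_projective_forget (P : ModuleCat.{u} (Smash 𝒜))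
    (hP : Projective ((forgetGrading 𝒜).obj P)) : Projective P where
  factors {E B} f e _ := by
    obtain ⟨φ, hφ⟩ := Projective.factors ((forgetGrading 𝒜).map f) ((forgetGrading 𝒜).map e)
    refine ⟨ModuleCat.ofHom (Smash.average 𝒜 (underlying₂ φ) (underlying₂_smul φ)), ?_⟩
    ext m
    change e.hom (Smash.average 𝒜 (underlying₂ φ) (underlying₂_smul φ) m) = f.hom m
    rw [Smash.average_apply, map_sum]
    conv_rhs => rw [← Smash.sum_idem_smul 𝒜 (f.hom m)]
    refine Finset.sum_congr rfl fun g _ => ?_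
    have h : e.hom (underlying₂ φ (Smash.idem 𝒜 g • m)) = f.hom (Smash.idem 𝒜 g • m) :=
      congrArg (fun ψ => underlying₂ ψ (Smash.idem 𝒜 g • m)) hφ
    rw [map_smul, h, map_smul, Smash.idem_smul_idem_smul, if_pos rfl]

namespace GradedProjections

variable {X : ModuleCat.{u} A} (p : GradedProjections 𝒜 X)

/-- The object of the category of modules over the smash product given by a graded module. -/
def obj : ModuleCat.{u} (Smash 𝒜) := ModuleCat.of (Smash 𝒜) p.Mod

/-- Forgetting the grading of a graded module gives back the module. -/
def forgetHom : (forgetGrading 𝒜).obj p.obj ⟶ X :=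
  mkUnderlying (N := p.obj) p.toMod.symm.toAddMonoidHom
    (fun a m => congrArg p.toMod.symm (p.const_smul_toMod a (p.toMod.symm m)))

/-- The inverse of `GradedProjections.forgetHom`. -/
def forgetInv : X ⟶ (forgetGrading 𝒜).obj p.obj :=
  ModuleCat.ofHom (Y := (forgetGrading 𝒜).obj p.obj)
    { p.toMod.toAddMonoidHom with map_smul' := fun a m => (p.const_smul_toMod a m).symm }

/-- Forgetting the grading of a graded module gives back the module. -/
def forgetIso : (forgetGrading 𝒜).obj p.obj ≅ X where
  hom := p.forgetHom
  inv := p.forgetInv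
  hom_inv_id := rfl
  inv_hom_id := rfl

/-- The identity map from `p.obj` to `X`. -/
def ofObj : p.obj ≃+ X := p.toMod.symm

theorem underlying_forgetIso_hom (m : p.obj) : underlying p.forgetIso.hom m = p.ofObj m := rfl

theorem ofObj_idem_smul (g : G) (m : p.obj) :
    p.ofObj (Smash.idem 𝒜 g • m) = p.proj g (p.ofObj m) :=
  congrArg p.toMod.symm (p.idem_smul_toMod g (p.toMod.symm m))

theorem ofObj_const_smul (a : A) (m : p.obj) :
    p.ofObj (Smash.const 𝒜 a • m) = a • p.ofObj m :=
  congrArg p.toMod.symm (p.const_smul_toMod a (p.toMod.symm m))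

theorem const_smul_ofObj_symm (a : A) (m : X) :
    Smash.const 𝒜 a • p.ofObj.symm m = p.ofObj.symm (a • m) :=
  p.const_smul_toMod a m

theorem ofObj_symm_underlying_smul {N : ModuleCat.{u} (Smash 𝒜)}
    (f : (forgetGrading 𝒜).obj N ⟶ X) (a : A) (n : N) :
    p.ofObj.symm.toAddMonoidHom.comp (underlying f) (Smash.const 𝒜 a • n) =
      Smash.const 𝒜 a • p.ofObj.symm.toAddMonoidHom.comp (underlying f) n :=
  (congrArg p.ofObj.symm (underlying_smul f a n)).trans (p.const_smul_ofObj_symm a _).symm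

/-- The part of degree zero of a linear map to a graded module. -/
def part {N : ModuleCat.{u} (Smash 𝒜)} (f : (forgetGrading 𝒜).obj N ⟶ X) : N ⟶ p.obj :=
  ModuleCat.ofHom (Smash.average 𝒜 (p.ofObj.symm.toAddMonoidHom.comp (underlying f))
    (p.ofObj_symm_underlying_smul f))

theorem ofObj_part {N : ModuleCat.{u} (Smash 𝒜)} (f : (forgetGrading 𝒜).obj N ⟶ X) (n : N) :
    p.ofObj ((p.part f).hom n) = ∑ g, p.proj g (underlying f (Smash.idem 𝒜 g • n)) := by
  refine (congrArg p.ofObj (Smash.average_apply 𝒜 _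
    (p.ofObj_symm_underlying_smul f) n)).trans ?_
  rw [map_sum]
  refine Finset.sum_congr rfl fun g _ => ?_
  rw [ofObj_idem_smul]
  rfl

/-- The value of `f` on an element of degree g splits into components. The component of degree g - k
has degree g in the shift by k, so it is contributed by the k-th part and by no other. -/
theorem sum_part {N : ModuleCat.{u} (Smash 𝒜)} (f : (forgetGrading 𝒜).obj N ⟶ X) :
    ∑ k, (forgetGrading 𝒜).map ((p.shift k).part f) ≫ (p.shift k).forgetIso.hom = f := by
  refine underlying_ext fun n => ?_
  rw [underlying_sum]
  simp only [underlying_map_comp, underlying_forgetIso_hom, ofObj_part]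
  rw [Finset.sum_comm]
  conv_rhs => rw [← Smash.sum_idem_smul 𝒜 n, map_sum]
  refine Finset.sum_congr rfl fun g _ => ?_
  conv_rhs => rw [← p.sum_proj (underlying f _)]
  exact Fintype.sum_equiv (Equiv.subLeft g) _ _ (fun k => rfl)

theorem part_map_self {N : ModuleCat.{u} (Smash 𝒜)} (f : N ⟶ p.obj) :
    p.part ((forgetGrading 𝒜).map f ≫ p.forgetIso.hom) = f := by
  ext n
  apply p.ofObj.injective
  rw [ofObj_part]
  simp only [underlying_map_comp, underlying_forgetIso_hom, map_smul, ofObj_idem_smul,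
    p.proj_proj, if_pos, p.sum_proj]

theorem part_map_of_ne {N : ModuleCat.{u} (Smash 𝒜)} {h k : G} (hk : h ≠ k)
    (f : N ⟶ (p.shift h).obj) :
    (p.shift k).part ((forgetGrading 𝒜).map f ≫ (p.shift h).forgetIso.hom) = 0 := by
  ext n
  apply (p.shift k).ofObj.injective
  rw [ofObj_part]
  refine (Finset.sum_eq_zero fun g _ => ?_).trans (map_zero (p.shift k).ofObj).symm
  rw [underlying_map_comp, underlying_forgetIso_hom, map_smul, ofObj_idem_smul]
  change p.proj (g - k) (p.proj (g - h) _) = 0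
  rw [p.proj_proj, if_neg (fun e => hk (sub_right_injective e).symm)]

end GradedProjections

end Parts

/-! ### From decompositions of Hom to decompositions of Ext -/

section ExtBijective

open Limits

variable {C D : Type*} [Category.{v} C] [Category.{w} D] [Abelian C] [Abelian D]
  [HasExt.{u} C] [HasExt.{u} D]

theorem sum_extMk {X Y : C} (R : ProjectiveResolution X) {n : ℕ} (m : ℕ) (hm : n + 1 = m)
    {ι : Type*} (s : Finset ι) (f : ι → (R.complex.X n ⟶ Y))
    (hf : ∀ i, R.complex.d m n ≫ f i = 0) :
    ∑ i ∈ s, R.extMk (f i) m hm (hf i) =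
      R.extMk (∑ i ∈ s, f i) m hm (by
        rw [Preadditive.comp_sum]; exact Finset.sum_eq_zero fun i _ => hf i) := by
  classical
  induction s using Finset.induction_on with
  | empty => simp
  | insert i s hi ih =>
    rw [Finset.sum_insert hi, ih, ProjectiveResolution.add_extMk]
    simp only [Finset.sum_insert hi]

variable (F : C ⥤ D) [F.Additive] [PreservesFiniteLimits F] [PreservesFiniteColimits F]
  [F.PreservesProjectiveObjects]
  {ι : Type*} [Fintype ι] {Y : ι → C} {Z : D} (θ : ∀ k, F.obj (Y k) ⟶ Z)

theorem map_comp_sum {M N : C} (d : M ⟶ N) (f : ∀ k, N ⟶ Y k) :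
    F.map d ≫ ∑ k, F.map (f k) ≫ θ k = ∑ k, F.map (d ≫ f k) ≫ θ k := by
  rw [Preadditive.comp_sum]
  simp only [F.map_comp, Category.assoc]

theorem sum_mapExactFunctor_extMk {N : C} (R : ProjectiveResolution N) {n : ℕ} (m : ℕ)
    (hm : n + 1 = m) (f : ∀ k, R.complex.X n ⟶ Y k) (hf : ∀ k, R.complex.d m n ≫ f k = 0)
    (hf' : (F.mapProjectiveResolution R).complex.d m n ≫ (∑ k, F.map (f k) ≫ θ k) = 0) :
    ∑ k, ((R.extMk (f k) m hm (hf k)).mapExactFunctor F).comp (Ext.mk₀ (θ k)) (add_zero n) =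
      (F.mapProjectiveResolution R).extMk (∑ k, F.map (f k) ≫ θ k) m hm hf' := by
  have h₁ : ∀ k, (F.mapProjectiveResolution R).complex.d m n ≫ F.map (f k) = 0 := fun k => by
    change F.map (R.complex.d m n) ≫ F.map (f k) = 0
    rw [← F.map_comp, hf, F.map_zero]
  have h₂ : ∀ k, (F.mapProjectiveResolution R).complex.d m n ≫ F.map (f k) ≫ θ k = 0 := fun k => by
    change F.map (R.complex.d m n) ≫ F.map (f k) ≫ θ k = 0
    rw [← F.map_comp_assoc, hf, F.map_zero, zero_comp]
  refine Eq.trans ?_ (sum_extMk (F.mapProjectiveResolution R) m hm Finset.univ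
    (fun k => F.map (f k) ≫ θ k) h₂)
  refine Finset.sum_congr rfl fun k _ => ?_
  rw [mapExactFunctor_extMk F R (f k) m hm (hf k) (h₁ k)]
  exact ProjectiveResolution.extMk_comp_mk₀ _ _ _ _ _ _

/-- If every map `F N ⟶ Z` is uniquely a sum of maps through `F (Y k)`, then so is every
class in `Ext^n (F N) Z`. -/
theorem bijective_sum_mapExactFunctor [EnoughProjectives C]
    (hθ : ∀ N : C, Function.Bijective fun f : ∀ k, N ⟶ Y k => ∑ k, F.map (f k) ≫ θ k)
    (N : C) (n : ℕ) :
    Function.Bijective fun β : ∀ k, Ext N (Y k) n =>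
      ∑ k, ((β k).mapExactFunctor F).comp (Ext.mk₀ (θ k)) (add_zero n) := by
  have hinj : ∀ {N : C} (f : ∀ k, N ⟶ Y k), ∑ k, F.map (f k) ≫ θ k = 0 → ∀ k, f k = 0 := by
    intro N f hf
    refine congrFun ((hθ N).1 (a₂ := fun _ => 0) (hf.trans ?_))
    simp
  let R : ProjectiveResolution N := Classical.choice HasProjectiveResolution.out
  have hadd : ∀ β γ : ∀ k, Ext N (Y k) n,
      ∑ k, (((β - γ) k).mapExactFunctor F).comp (Ext.mk₀ (θ k)) (add_zero n) =
      (∑ k, ((β k).mapExactFunctor F).comp (Ext.mk₀ (θ k)) (add_zero n)) -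
        ∑ k, ((γ k).mapExactFunctor F).comp (Ext.mk₀ (θ k)) (add_zero n) := by
    intro β γ
    rw [← Finset.sum_sub_distrib]
    refine Finset.sum_congr rfl fun k _ => ?_
    exact (map_sub ((Ext.postcomp (Ext.mk₀ (θ k)) (F.obj N) (add_zero n)).comp
      (F.mapExtAddHom N (Y k) n)) (β k) (γ k))
  constructor
  · intro β γ hβγ
    rw [← sub_eq_zero]
    have h0 := (hadd β γ).trans (sub_eq_zero.2 hβγ)
    generalize β - γ = δ at h0
    funext k
    -- The vanishing criterion for the class of a cocycle refers to the preceding term of the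
    -- resolution. Degree 0, where Ext is Hom, is therefore separate.
    cases n with
    | zero =>
      obtain ⟨f, rfl⟩ : ∃ f : ∀ k, N ⟶ Y k, δ = fun k => Ext.mk₀ (f k) :=
        ⟨fun k => Ext.homEquiv₀ (δ k), funext fun k => (Ext.mk₀_homEquiv₀_apply (δ k)).symm⟩
      simp only [Ext.mapExactFunctor_mk₀, Ext.mk₀_comp_mk₀] at h0
      have h1 : Ext.mk₀ (∑ k, F.map (f k) ≫ θ k) = 0 := by
        rw [← h0]
        exact map_sum (Ext.addEquiv₀ (X := F.obj N) (Y := Z)).symm _ _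
      have h2 := hinj f ((Ext.mk₀_eq_zero_iff _).1 h1)
      simp [h2]
    | succ p =>
      choose f hf hδ using fun k => R.extMk_surjective (δ k) (p + 2) rfl
      have hf' : (F.mapProjectiveResolution R).complex.d (p + 2) (p + 1) ≫
          (∑ k, F.map (f k) ≫ θ k) = 0 := by
        refine (map_comp_sum F θ (R.complex.d (p + 2) (p + 1)) f).trans ?_
        simp only [hf, F.map_zero, zero_comp, Finset.sum_const_zero]
        rfl
      simp only [← hδ] at h0
      rw [sum_mapExactFunctor_extMk F θ R (p + 2) rfl f hf hf'] at h0
      -- The cochain that bounds the total cocycle decomposes by `hθ`. By uniqueness of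
      -- decompositions one degree higher, its k-th part bounds the k-th cocycle.
      obtain ⟨g, hg⟩ := (ProjectiveResolution.extMk_eq_zero_iff _ _ _ _ _ p rfl).1 h0
      obtain ⟨φ, rfl⟩ := (hθ (R.complex.X p)).2 g
      have : ∀ k, R.complex.d (p + 1) p ≫ φ k = f k :=
        congrFun ((hθ _).1 ((map_comp_sum F θ (R.complex.d (p + 1) p) φ).symm.trans hg))
      rw [← hδ]
      exact (ProjectiveResolution.extMk_eq_zero_iff _ _ _ _ _ p rfl).2 ⟨φ k, this k⟩
  · intro α
    obtain ⟨f, hf, rfl⟩ := (F.mapProjectiveResolution R).extMk_surjective α (n + 1) rfl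
    -- A cocycle decomposes as a cochain. Its parts are themselves cocycles, because the
    -- decomposition of its zero coboundary is unique.
    obtain ⟨φ, rfl⟩ := (hθ (R.complex.X n)).2 f
    have hφ : ∀ k, R.complex.d (n + 1) n ≫ φ k = 0 := hinj _
      ((map_comp_sum F θ (R.complex.d (n + 1) n) φ).symm.trans hf)
    exact ⟨fun k => R.extMk (φ k) (n + 1) rfl (hφ k),
      sum_mapExactFunctor_extMk F θ R (n + 1) rfl φ hφ hf⟩

end ExtBijective

/-! ### The action of an exact functor on Ext, conjugated by morphisms -/

section ExtConj

open Limits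

variable {C D : Type*} [Category.{v} C] [Category.{w} D] [Abelian C] [Abelian D]
  [HasExt.{u} C] [HasExt.{u} D] (K : Type*) [Field K] [Linear K C] [Linear K D]
  (F : C ⥤ D) [F.Additive] [PreservesFiniteLimits F] [PreservesFiniteColimits F] [F.Linear K]

/-- The map `β ↦ a · F β · b` on `Ext`. -/
def extConj {X Y : D} {M N : C} (a : X ⟶ F.obj M) (b : F.obj N ⟶ Y) (n : ℕ) :
    Ext M N n →ₗ[K] Ext X Y n where
  toFun β := (Ext.mk₀ a).comp ((β.mapExactFunctor F).comp (Ext.mk₀ b) (add_zero n)) (zero_add n)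
  map_add' β γ := by
    rw [Ext.mapExactFunctor_add, Ext.add_comp, Ext.comp_add]
  map_smul' r β := by
    rw [Functor.mapExactFunctor_smul, Ext.smul_comp, Ext.comp_smul, RingHom.id_apply]

variable {X Y Z : D} {L M N : C}

theorem extConj_apply (a : X ⟶ F.obj M) (b : F.obj N ⟶ Y) {n : ℕ} (β : Ext M N n) :
    extConj K F a b n β =
      (Ext.mk₀ a).comp ((β.mapExactFunctor F).comp (Ext.mk₀ b) (add_zero n)) (zero_add n) := rfl

theorem extConj_mk₀ (a : X ⟶ F.obj M) (b : F.obj N ⟶ Y) (f : M ⟶ N) :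
    extConj K F a b 0 (Ext.mk₀ f) = Ext.mk₀ (a ≫ F.map f ≫ b) := by
  simp only [extConj_apply, Ext.mapExactFunctor_mk₀, Ext.mk₀_comp_mk₀]

theorem extConj_mk₀_comp (a : X ⟶ F.obj L) (f : L ⟶ M) (b : F.obj N ⟶ Y) {n : ℕ}
    (β : Ext M N n) :
    extConj K F a b n ((Ext.mk₀ f).comp β (zero_add n)) =
      extConj K F (a ≫ F.map f) b n β := by
  simp only [extConj_apply, Ext.mapExactFunctor_comp, Ext.mapExactFunctor_mk₀]
  rw [← Ext.mk₀_comp_mk₀, Ext.comp_assoc_of_third_deg_zero, Ext.comp_assoc _ _ _ (zero_add 0) (zero_add n) (by lia)]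

theorem extConj_comp_mk₀ (a : X ⟶ F.obj L) (f : M ⟶ N) (b : F.obj N ⟶ Y) {n : ℕ}
    (β : Ext L M n) :
    extConj K F a b n (β.comp (Ext.mk₀ f) (add_zero n)) =
      extConj K F a (F.map f ≫ b) n β := by
  simp only [extConj_apply, Ext.mapExactFunctor_comp, Ext.mapExactFunctor_mk₀]
  rw [← Ext.mk₀_comp_mk₀, Ext.comp_assoc_of_third_deg_zero]

/-- Inserting an identity of F M written as a sum of composites through the `W i` expresses a
product of classes as a sum of products. With several indices this becomes matrix multiplication;
with a single index it says that forgetting gradings is multiplicative. -/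
theorem sum_extConj_comp_extConj {ι : Type*} [Fintype ι] {W : ι → D} (a : X ⟶ F.obj L)
    (b : ∀ i, F.obj M ⟶ W i) (c : ∀ i, W i ⟶ F.obj M) (d : F.obj N ⟶ Z)
    (h : ∑ i, b i ≫ c i = 𝟙 _) {n m l : ℕ} (hl : n + m = l) (β : Ext L M n) (γ : Ext M N m) :
    ∑ i, (extConj K F a (b i) n β).comp (extConj K F (c i) d m γ) hl =
      extConj K F a d l (β.comp γ hl) := by
  have key : ∀ i, (extConj K F a (b i) n β).comp (extConj K F (c i) d m γ) hl =
      (Ext.mk₀ a).comp ((β.mapExactFunctor F).comp ((Ext.mk₀ (b i ≫ c i)).comp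
        ((γ.mapExactFunctor F).comp (Ext.mk₀ d) (add_zero m)) (zero_add m)) hl) (zero_add l) := by
    intro i
    simp only [extConj_apply]
    rw [Ext.comp_assoc _ _ _ (zero_add n) hl (by lia), Ext.comp_assoc_of_second_deg_zero,
      ← Ext.mk₀_comp_mk₀, Ext.comp_assoc _ _ _ (zero_add 0) (zero_add m) (by lia)]
  simp only [key]
  rw [← Ext.comp_sum, ← Ext.comp_sum, ← Ext.sum_comp, ← Ext.mk₀_sum, h, Ext.mk₀_id_comp,
    extConj_apply, Ext.mapExactFunctor_comp, Ext.comp_assoc_of_third_deg_zero]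

theorem extConj_comp_extConj {W : D} (a : X ⟶ F.obj L) (b : F.obj M ⟶ W) (c : W ⟶ F.obj M)
    (d : F.obj N ⟶ Z) (h : b ≫ c = 𝟙 _) {n m l : ℕ} (hl : n + m = l) (β : Ext L M n)
    (γ : Ext M N m) :
    (extConj K F a b n β).comp (extConj K F c d m γ) hl = extConj K F a d l (β.comp γ hl) := by
  have := sum_extConj_comp_extConj K F a (fun _ : Unit => b) (fun _ => c) d (by simpa using h)
    hl β γ
  simpa using this

theorem bijective_sum_extConj [EnoughProjectives C] [F.PreservesProjectiveObjects]
    {ι : Type*} [Fintype ι] {W : ι → C} (θ : ∀ k, F.obj (W k) ⟶ Y)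
    (hθ : ∀ N : C, Function.Bijective fun f : ∀ k, N ⟶ W k => ∑ k, F.map (f k) ≫ θ k)
    (e : X ≅ F.obj M) (n : ℕ) :
    Function.Bijective fun β : ∀ k, Ext M (W k) n => ∑ k, extConj K F e.hom (θ k) n (β k) := by
  have h₁ := bijective_sum_mapExactFunctor F θ hθ M n
  have h₂ : Function.Bijective fun γ : Ext (F.obj M) Y n => (Ext.mk₀ e.hom).comp γ (zero_add n) := by
    refine Function.bijective_iff_has_inverse.2
      ⟨fun γ => (Ext.mk₀ e.inv).comp γ (zero_add n), fun γ => ?_, fun γ => ?_⟩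
    · simp only [Ext.mk₀_comp_mk₀_assoc, e.inv_hom_id, Ext.mk₀_id_comp]
    · simp only [Ext.mk₀_comp_mk₀_assoc, e.hom_inv_id, Ext.mk₀_id_comp]
  convert h₂.comp h₁ using 1
  funext β
  exact (Ext.comp_sum (Ext.mk₀ e.hom) (fun k => ((β k).mapExactFunctor F).comp (Ext.mk₀ (θ k))
    (add_zero n)) (zero_add n)).symm

/-- The augmentation of a projective resolution. -/
def augmentation {X : D} (P : ProjectiveResolution X) : P.complex.X 0 ⟶ X := P.π.f 0

theorem augmentation_map [F.PreservesProjectiveObjects] (R : ProjectiveResolution M) :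
    augmentation (F.mapProjectiveResolution R) = F.map (augmentation R) := by
  have h : (F.mapProjectiveResolution R).π =
    (F.mapHomologicalComplex _).map R.π ≫
      (HomologicalComplex.singleMapHomologicalComplex F (ComplexShape.down ℕ) 0).hom.app M := rfl
  have h₂ := congrArg (fun φ => φ.f 0) h
  refine h₂.trans ?_
  refine (HomologicalComplex.comp_f _ _ 0).trans ?_
  rw [HomologicalComplex.singleMapHomologicalComplex_hom_app_self]
  exact map_comp_map_id_comp_id F (augmentation R)

theorem hom_f_zero_comp_π_f_zero_of_augmentation {X Y : D} (P : ProjectiveResolution X)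
    (Q : ProjectiveResolution Y) (a : X ⟶ Y) (f : P.complex.X 0 ⟶ Q.complex.X 0)
    (h : f ≫ augmentation Q = augmentation P ≫ a) :
    f ≫ Q.π.f 0 = P.π.f 0 ≫ ((ChainComplex.single₀ D).map a).f 0 := by
  rw [ChainComplex.single₀_map_f_zero]
  exact h

/-- The chain map `φ` lifts `a`, so composing a class with `a` amounts to pulling its cocycle back
along `φ`. -/
theorem extConj_extMk [F.PreservesProjectiveObjects] (R : ProjectiveResolution M)
    (P : ProjectiveResolution X) (a : X ⟶ F.obj M) (b : F.obj N ⟶ Y)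
    (φ : P.complex ⟶ (F.mapHomologicalComplex _).obj R.complex)
    (hφ : φ.f 0 ≫ F.map (augmentation R) = augmentation P ≫ a)
    {n : ℕ} (f : R.complex.X n ⟶ N) (m : ℕ) (hm : n + 1 = m) (hf : R.complex.d m n ≫ f = 0)
    (hf' : P.complex.d m n ≫ φ.f n ≫ F.map f ≫ b = 0) :
    extConj K F a b n (R.extMk f m hm hf) = P.extMk (φ.f n ≫ F.map f ≫ b) m hm hf' := by
  have h₁ : (F.mapProjectiveResolution R).complex.d m n ≫ F.map f = 0 := by
    change F.map (R.complex.d m n) ≫ F.map f = 0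
    rw [← F.map_comp, hf, F.map_zero]
  let ψ : ProjectiveResolution.Hom P (F.mapProjectiveResolution R) a :=
    { hom := φ
      hom_f_zero_comp_π_f_zero := hom_f_zero_comp_π_f_zero_of_augmentation P
        (F.mapProjectiveResolution R) a (φ.f 0)
        ((congrArg (fun g => φ.f 0 ≫ g) (augmentation_map F R)).trans hφ) }
  rw [extConj_apply, mapExactFunctor_extMk F R f m hm hf h₁]
  refine (congrArg (fun γ => (Ext.mk₀ a).comp γ (zero_add n))
    (ProjectiveResolution.extMk_comp_mk₀ (F.mapProjectiveResolution R) _ m hm h₁ b)).trans ?_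
  exact ProjectiveResolution.mk₀_comp_extMk _ _ _ _ ψ

/-- A complex of projective objects that becomes a projective resolution under an exact functor
that reflects isomorphisms is a projective resolution. -/
def resolutionOfMap [F.ReflectsIsomorphisms] (P : ProjectiveResolution X)
    (Q : ChainComplex C ℕ) (hQ : ∀ n, Projective (Q.X n)) (ε : Q.X 0 ⟶ M) (hε : Q.d 1 0 ≫ ε = 0)
    (a : X ≅ F.obj M) (φ : P.complex ≅ (F.mapHomologicalComplex _).obj Q)
    (hφ : φ.hom.f 0 ≫ F.map ε = augmentation P ≫ a.hom) : ProjectiveResolution M where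
  complex := Q
  projective := hQ
  π := (ChainComplex.toSingle₀Equiv Q M).symm ⟨ε, hε⟩
  quasiIso := by
    let ψ := (ChainComplex.toSingle₀Equiv Q M).symm ⟨ε, hε⟩
    have h₁ : P.π ≫ (ChainComplex.single₀ D).map a.hom =
        φ.hom ≫ (F.mapHomologicalComplex _).map ψ ≫
          (HomologicalComplex.singleMapHomologicalComplex F (ComplexShape.down ℕ) 0).hom.app M := by
      apply HomologicalComplex.to_single_hom_ext
      have h : ψ.f 0 = ε := ChainComplex.toSingle₀Equiv_symm_apply_f_zero ε hε
      have e₁ : (P.π ≫ (ChainComplex.single₀ D).map a.hom).f 0 = augmentation P ≫ a.hom := by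
        rw [HomologicalComplex.comp_f, ChainComplex.single₀_map_f_zero]
        rfl
      refine e₁.trans (hφ.symm.trans ?_)
      rw [HomologicalComplex.comp_f, HomologicalComplex.comp_f,
        HomologicalComplex.singleMapHomologicalComplex_hom_app_self]
      refine congrArg (fun g => φ.hom.f 0 ≫ g) ?_
      exact (congrArg F.map h.symm).trans (map_comp_map_id_comp_id F (ψ.f 0)).symm
    rw [← HomologicalComplex.quasiIso_map_iff_of_preservesHomology _ F]
    have h₂ : (F.mapHomologicalComplex _).map ψ =
      φ.inv ≫ (P.π ≫ (ChainComplex.single₀ D).map a.hom) ≫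
        (HomologicalComplex.singleMapHomologicalComplex F (ComplexShape.down ℕ) 0).inv.app M := by
      rw [h₁]
      simp
    change QuasiIso ((F.mapHomologicalComplex _).map ψ)
    rw [h₂]
    infer_instance

theorem augmentation_resolutionOfMap [F.ReflectsIsomorphisms] (P : ProjectiveResolution X)
    (Q : ChainComplex C ℕ) (hQ : ∀ n, Projective (Q.X n)) (ε : Q.X 0 ⟶ M) (hε : Q.d 1 0 ≫ ε = 0)
    (a : X ≅ F.obj M) (φ : P.complex ≅ (F.mapHomologicalComplex _).obj Q)
    (hφ : φ.hom.f 0 ≫ F.map ε = augmentation P ≫ a.hom) :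
    augmentation (resolutionOfMap F P Q hQ ε hε a φ hφ) = ε :=
  ChainComplex.toSingle₀Equiv_symm_apply_f_zero ε hε

/-- The image of a projective resolution of `M` as a projective resolution of an object isomorphic
to `F M`. -/
def mapResolution [F.PreservesProjectiveObjects] (R : ProjectiveResolution M) (e : F.obj M ≅ X) :
    ProjectiveResolution X where
  complex := (F.mapProjectiveResolution R).complex
  projective := (F.mapProjectiveResolution R).projective
  hasHomology := (F.mapProjectiveResolution R).hasHomology
  π := (F.mapProjectiveResolution R).π ≫ (ChainComplex.single₀ D).map e.hom
  quasiIso := inferInstance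

theorem augmentation_mapResolution [F.PreservesProjectiveObjects] (R : ProjectiveResolution M)
    (e : F.obj M ≅ X) :
    augmentation (mapResolution F R e) = F.map (augmentation R) ≫ e.hom := by
  have e₁ : ((F.mapProjectiveResolution R).π ≫ (ChainComplex.single₀ D).map e.hom).f 0 =
      augmentation (F.mapProjectiveResolution R) ≫ e.hom := by
    rw [HomologicalComplex.comp_f, ChainComplex.single₀_map_f_zero]
    rfl
  exact e₁.trans (congrArg (fun g => g ≫ e.hom) (augmentation_map F R))

theorem extConj_extMk_mapResolution [F.PreservesProjectiveObjects] (R : ProjectiveResolution M)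
    (e : F.obj M ≅ X) (b : F.obj N ⟶ Y)
    {n : ℕ} (f : R.complex.X n ⟶ N) (m : ℕ) (hm : n + 1 = m) (hf : R.complex.d m n ≫ f = 0) :
    ∃ hf', extConj K F e.inv b n (R.extMk f m hm hf) =
      (mapResolution F R e).extMk (F.map f ≫ b) m hm hf' := by
  have h₁ : F.map (R.complex.d m n) ≫ F.map f ≫ b = 0 := by
    rw [← F.map_comp_assoc, hf, F.map_zero, zero_comp]
  have h₂ : (mapResolution F R e).complex.d m n ≫ 𝟙 _ ≫ F.map f ≫ b = 0 :=
    (congrArg (fun g => F.map (R.complex.d m n) ≫ g) (Category.id_comp (F.map f ≫ b))).trans h₁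
  have h := extConj_extMk K F R (mapResolution F R e) e.inv b (𝟙 _) (by
    refine (Category.id_comp (F.map (augmentation R))).trans ?_
    rw [augmentation_mapResolution]
    exact ((Category.assoc (F.map (augmentation R)) e.hom e.inv).trans
      (by rw [e.hom_inv_id, Category.comp_id])).symm) f m hm hf h₂
  refine ⟨h₁, h.trans ?_⟩
  congr 1
  exact Category.id_comp (F.map f ≫ b)

end ExtConj

/-! ### Gradings by subgroups and gradings by projections -/

section Components

variable {K : Type*} [Field K] {G : Type*} [AddGroup G] [Fintype G] [DecidableEq G]
  {A : Type*} [Ring A] [Algebra K A] {𝒜 : G → Submodule K A} [GradedAlgebra 𝒜]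

theorem proj_of_mem {a : A} {g : G} (ha : a ∈ 𝒜 g) (h : G) :
    GradedRing.proj 𝒜 h a = if h = g then a else 0 := by
  rw [GradedRing.proj_apply]
  split_ifs with hg
  · rw [hg, DirectSum.decompose_of_mem_same 𝒜 ha]
  · rw [DirectSum.decompose_of_mem_ne 𝒜 ha (Ne.symm hg)]

namespace GradedProjections

variable {M N : Type*} [AddCommGroup M] [Module A M] [AddCommGroup N] [Module A N]

theorem smul_mem (p : GradedProjections 𝒜 M) {g h : G} {a : A} {m : M} (ha : a ∈ 𝒜 g)
    (hm : m ∈ p.component h) : a • m ∈ p.component (g + h) := by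
  rw [mem_component, p.proj_smul, Finset.sum_eq_single h]
  · rw [QuasiKoszul.proj_of_mem ha, add_sub_cancel_right, if_pos rfl, p.proj_of_mem hm, if_pos rfl]
  · intro k _ hk
    rw [p.proj_of_mem hm, if_neg hk, smul_zero]
  · simp

/-- The projection to degree g recovers the g-th coordinate of an element of the external sum, which
gives injectivity. Surjectivity holds because the projections add up to the identity. -/
theorem isInternal (p : GradedProjections 𝒜 M) : DirectSum.IsInternal p.component := by
  classical
  have key : ∀ (x : ⨁ g, p.component g) (g : G),
      p.proj g (DirectSum.coeAddMonoidHom p.component x) = x g := by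
    intro x g
    induction x using DirectSum.induction_on with
    | zero => simp
    | of h y =>
      rw [DirectSum.coeAddMonoidHom_of, p.proj_of_mem y.2, DirectSum.of_apply]
      split_ifs with h₁ h₂ h₂
      · subst h₁
        rfl
      · exact absurd h₁.symm h₂
      · exact absurd h₂.symm h₁
      · rfl
    | add x y hx hy => rw [map_add, map_add, hx, hy]; rfl
  constructor
  · intro x y hxy
    refine DFinsupp.ext fun g => Subtype.ext ?_
    rw [← key, ← key]
    exact congrArg _ hxy
  · intro m
    refine ⟨∑ g, DirectSum.of (fun g => p.component g) g ⟨p.proj g m, p.proj_mem g m⟩, ?_⟩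
    rw [map_sum]
    simp only [DirectSum.coeAddMonoidHom_of]
    exact p.sum_proj m

theorem map_proj (p : GradedProjections 𝒜 M) (q : GradedProjections 𝒜 N) (f : M →+ N)
    (hf : ∀ g m, m ∈ p.component g → f m ∈ q.component g) (g : G) (m : M) :
    f (p.proj g m) = q.proj g (f m) := by
  conv_rhs => rw [← p.sum_proj m, map_sum, map_sum]
  rw [Finset.sum_eq_single g]
  · exact ((q.mem_component _ _).1 (hf g _ (p.proj_mem g m))).symm
  · intro h _ hh
    rw [q.proj_of_mem (hf h _ (p.proj_mem h m)), if_neg (Ne.symm hh)]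
  · simp

/-- The projections of a module over the smash product. -/
def ofSmash (L : Type*) [AddCommGroup L] [Module (Smash 𝒜) L] [Module A L]
    (hL : ∀ (a : A) (x : L), a • x = Smash.const 𝒜 a • x) : GradedProjections 𝒜 L where
  proj g := DistribSMul.toAddMonoidHom L (Smash.idem 𝒜 g)
  proj_proj g h m := Smash.idem_smul_idem_smul 𝒜 g h m
  sum_proj m := Smash.sum_idem_smul 𝒜 m
  proj_smul g a m := by
    simp only [DistribSMul.toAddMonoidHom_apply, hL]
    rw [← mul_smul, Smash.idem_mul_const, Finset.sum_smul]
    simp only [mul_smul]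

section OfDecomposition

variable {σ : Type*} [SetLike σ M] [AddSubmonoidClass σ M] (ℳ : G → σ)
  [DirectSum.Decomposition ℳ]

theorem sum_decompose (m : M) : ∑ g, (DirectSum.decompose ℳ m g : M) = m := by
  classical
  conv_rhs => rw [← DirectSum.sum_support_decompose ℳ m]
  refine (Finset.sum_subset (Finset.subset_univ _) fun g _ hg => ?_).symm
  simpa using hg

/-- The projections of a graded module. -/
def ofDecomposition
    (hℳ : ∀ (g h : G) (a : A) (m : M), a ∈ 𝒜 g → m ∈ ℳ h → a • m ∈ ℳ (g + h)) :
    GradedProjections 𝒜 M where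
  proj g := AddMonoidHom.mk' (fun m => (DirectSum.decompose ℳ m g : M)) fun m n => by
    rw [DirectSum.decompose_add]; rfl
  proj_proj g h m := by
    change (DirectSum.decompose ℳ (DirectSum.decompose ℳ m h : M) g : M) = _
    split_ifs with hg
    · subst hg
      exact DirectSum.decompose_of_mem_same ℳ (SetLike.coe_mem _)
    · exact DirectSum.decompose_of_mem_ne ℳ (SetLike.coe_mem _) (Ne.symm hg)
  sum_proj m := sum_decompose ℳ m
  proj_smul g a m := by
    have hadd : ∀ g, ∃ f : M →+ M, ∀ m, f m = (DirectSum.decompose ℳ m g : M) := fun g =>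
      ⟨AddMonoidHom.mk' (fun m => (DirectSum.decompose ℳ m g : M)) fun m n => by
        rw [DirectSum.decompose_add]; rfl, fun _ => rfl⟩
    change (DirectSum.decompose ℳ (a • m) g : M) =
      ∑ h, GradedRing.proj 𝒜 (g - h) a • (DirectSum.decompose ℳ m h : M)
    conv_lhs => rw [← sum_decompose ℳ m, Finset.smul_sum]
    obtain ⟨f, hf⟩ := hadd g
    rw [← hf, map_sum]
    refine Finset.sum_congr rfl fun h _ => ?_
    conv_lhs => rw [← QuasiKoszul.sum_proj_sub 𝒜 a h, Finset.sum_smul, map_sum]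
    rw [Finset.sum_eq_single g]
    · rw [hf]
      refine DirectSum.decompose_of_mem_same ℳ ?_
      have := hℳ (g - h) h _ _ (SetLike.coe_mem (DirectSum.decompose 𝒜 a (g - h)))
        (SetLike.coe_mem (DirectSum.decompose ℳ m h))
      rwa [sub_add_cancel] at this
    · intro k _ hk
      rw [hf]
      refine DirectSum.decompose_of_mem_ne ℳ (i := k) ?_ hk
      have := hℳ (k - h) h _ _ (SetLike.coe_mem (DirectSum.decompose 𝒜 a (k - h)))
        (SetLike.coe_mem (DirectSum.decompose ℳ m h))
      rwa [sub_add_cancel] at this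
    · simp

theorem mem_component_ofDecomposition
    (hℳ : ∀ (g h : G) (a : A) (m : M), a ∈ 𝒜 g → m ∈ ℳ h → a • m ∈ ℳ (g + h)) (g : G) (m : M) :
    m ∈ (ofDecomposition ℳ hℳ).component g ↔ m ∈ ℳ g := by
  rw [mem_component]
  change (DirectSum.decompose ℳ m g : M) = m ↔ _
  constructor
  · intro h
    rw [← h]
    exact SetLike.coe_mem _
  · exact DirectSum.decompose_of_mem_same ℳ

end OfDecomposition

end GradedProjections

end Components

/-! ### The grading on Ext and Ext over the smash product -/

section ExtDegree

variable {K : Type*} [Field K] {G : Type u} [AddGroup G] [Fintype G] [DecidableEq G]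
  {A : Type u} [Ring A] [Algebra K A] {𝒜 : G → Submodule K A} [GradedAlgebra 𝒜]

instance : Limits.PreservesFiniteLimits (forgetGrading 𝒜) where
  preservesFiniteLimits _ _ _ := ⟨inferInstance⟩

namespace GradedProjections

variable {X Y Z : ModuleCat.{u} A} (p : GradedProjections 𝒜 X) (q : GradedProjections 𝒜 Y)

/-- Existence is `sum_part`. For uniqueness, the k-th part of a sum of graded maps returns the k-th
summand and annihilates the others. -/
theorem bijective_sum_map_comp (N : ModuleCat.{u} (Smash 𝒜)) :
    Function.Bijective fun f : ∀ k, N ⟶ (p.shift k).obj =>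
      ∑ k, (forgetGrading 𝒜).map (f k) ≫ (p.shift k).forgetIso.hom := by
  constructor
  · intro f g hfg
    have key : ∀ (f : ∀ k, N ⟶ (p.shift k).obj) (k : G), (p.shift k).part
        (∑ l, (forgetGrading 𝒜).map (f l) ≫ (p.shift l).forgetIso.hom) = f k := by
      intro f k
      have hsum : ∀ φ : G → ((forgetGrading 𝒜).obj N ⟶ X),
          (p.shift k).part (∑ l, φ l) = ∑ l, (p.shift k).part (φ l) := by
        intro φ
        ext n
        apply (p.shift k).ofObj.injective
        refine ((p.shift k).ofObj_part _ n).trans ?_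
        rw [ModuleCat.hom_sum, LinearMap.sum_apply]
        refine Eq.trans ?_ (map_sum (p.shift k).ofObj _ _).symm
        simp only [ofObj_part, underlying_sum, map_sum]
        exact Finset.sum_comm
      rw [hsum, Finset.sum_eq_single k]
      · exact (p.shift k).part_map_self (f k)
      · intro l _ hl
        exact p.part_map_of_ne hl (f l)
      · simp
    funext k
    rw [← key f k, ← key g k]
    exact congrArg _ hfg
  · intro f
    exact ⟨fun k => (p.shift k).part f, p.sum_part f⟩

variable (K) in
/-- The map on `Ext` that forgets the gradings. -/
def extForget (n : ℕ) : Ext p.obj q.obj n →ₗ[K] Ext X Y n :=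
  extConj K (forgetGrading 𝒜) p.forgetIso.inv q.forgetIso.hom n

theorem extForget_comp (r : GradedProjections 𝒜 Z) {n m l : ℕ} (hl : n + m = l)
    (β : Ext p.obj q.obj n) (γ : Ext q.obj r.obj m) :
    (extForget K p q n β).comp (extForget K q r m γ) hl = extForget K p r l (β.comp γ hl) :=
  extConj_comp_extConj K (forgetGrading 𝒜) _ _ _ _ q.forgetIso.hom_inv_id hl β γ

theorem extForget_id : extForget K p p 0 (Ext.mk₀ (𝟙 p.obj)) = Ext.mk₀ (𝟙 X) := by
  refine (extConj_mk₀ K (forgetGrading 𝒜) p.forgetIso.inv p.forgetIso.hom (𝟙 p.obj)).trans ?_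
  rw [CategoryTheory.Functor.map_id, Category.id_comp, Iso.inv_hom_id]

theorem bijective_sum_extForget (n : ℕ) :
    Function.Bijective fun β : ∀ k, Ext p.obj (q.shift k).obj n =>
      ∑ k, extForget K p (q.shift k) n (β k) :=
  bijective_sum_extConj K (forgetGrading 𝒜) (fun k => (q.shift k).forgetIso.hom)
    q.bijective_sum_map_comp p.forgetIso.symm n

/-- A linear map of degree zero as a linear map over the smash product. -/
def liftHom (f : X ⟶ Y) (hf : ∀ g x, x ∈ p.component g → f.hom x ∈ q.component g) :
    p.obj ⟶ q.obj :=
  ModuleCat.ofHom (Smash.mkLinear 𝒜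
    (q.ofObj.symm.toAddMonoidHom.comp (f.hom.toAddMonoidHom.comp p.ofObj.toAddMonoidHom))
    (fun a m => (congrArg (fun x => q.ofObj.symm (f.hom x)) (p.ofObj_const_smul a m)).trans
      ((congrArg q.ofObj.symm (map_smul f.hom a _)).trans (q.const_smul_ofObj_symm a _).symm))
    (fun g m => q.ofObj.injective <|
      (congrArg f.hom (p.ofObj_idem_smul g m)).trans
        ((p.map_proj q f.hom.toAddMonoidHom hf g (p.ofObj m)).trans
          (q.ofObj_idem_smul g (q.ofObj.symm (f.hom (p.ofObj m)))).symm)))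

theorem liftHom_comp_liftHom_eq_zero (r : GradedProjections 𝒜 Z) (f : X ⟶ Y) (g : Y ⟶ Z)
    (hf : ∀ g x, x ∈ p.component g → f.hom x ∈ q.component g)
    (hg : ∀ h x, x ∈ q.component h → g.hom x ∈ r.component h) (h : f ≫ g = 0) :
    liftHom p q f hf ≫ liftHom q r g hg = 0 := by
  ext m
  exact congrArg r.ofObj.symm (congrArg (fun φ => φ.hom (p.ofObj m)) h)

theorem ofObj_hom_mem {N : ModuleCat.{u} (Smash 𝒜)} (f : N ⟶ p.obj) (g : G) (n : N)
    (hn : Smash.idem 𝒜 g • n = n) : p.ofObj (f.hom n) ∈ p.component g := by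
  rw [p.mem_component, ← p.ofObj_idem_smul, ← map_smul, hn]

/-- The projections of a module over the smash product. -/
def ofForget (N : ModuleCat.{u} (Smash 𝒜)) : GradedProjections 𝒜 ((forgetGrading 𝒜).obj N) :=
  letI : Module (Smash 𝒜) ((forgetGrading 𝒜).obj N) := inferInstanceAs (Module (Smash 𝒜) N)
  ofSmash ((forgetGrading 𝒜).obj N) fun _ _ => rfl

theorem mem_component_ofForget (N : ModuleCat.{u} (Smash 𝒜)) (g : G) (n : N) :
    n ∈ (ofForget N).component g ↔ Smash.idem 𝒜 g • n = n :=
  (ofForget N).mem_component g n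

/-- A resolution over the smash product as a graded resolution. -/
def gradedResolution (h : G) (R : ProjectiveResolution (p.shift h).obj) :
    GradedResolution 𝒜 X p.component where
  toProjectiveResolution := mapResolution (forgetGrading 𝒜) R (p.shift h).forgetIso
  grading n g := (ofForget (R.complex.X n)).component (g + h)
  isInternal n := by
    -- Resolving the shift by h raises all degrees by h. Shifting back by -h makes the augmentation
    -- to the unshifted module preserve degrees.
    have := ((ofForget (R.complex.X n)).shift (-h)).isInternal
    have e : ((ofForget (R.complex.X n)).shift (-h)).component =
        fun g => (ofForget (R.complex.X n)).component (g + h) := by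
      funext g
      change (ofForget (R.complex.X n)).component (g - -h) = _
      rw [sub_neg_eq_add]
    rw [e] at this
    exact this
  smul_mem n g k a x ha hx := by
    rw [add_assoc]
    exact (ofForget (R.complex.X n)).smul_mem ha hx
  d_mem n g x hx := by
    have h₁ : Smash.idem 𝒜 (g + h) • (show R.complex.X (n + 1) from x) = x :=
      (mem_component_ofForget _ _ _).1 hx
    refine (mem_component_ofForget (R.complex.X n) (g + h) _).2 ?_
    refine (map_smul (R.complex.d (n + 1) n).hom (Smash.idem 𝒜 (g + h))
      (show R.complex.X (n + 1) from x)).symm.trans ?_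
    exact congrArg (R.complex.d (n + 1) n).hom h₁
  augmentation_mem g x hx := by
    have h₁ : Smash.idem 𝒜 (g + h) • (show R.complex.X 0 from x) = x :=
      (mem_component_ofForget _ _ _).1 hx
    have h₂ := (p.shift h).ofObj_hom_mem (augmentation R) (g + h) (show R.complex.X 0 from x) h₁
    have h₃ : (augmentation (mapResolution (forgetGrading 𝒜) R (p.shift h).forgetIso)).hom x =
        (p.shift h).ofObj ((augmentation R).hom (show R.complex.X 0 from x)) :=
      congrArg (fun φ => φ.hom x)
        (augmentation_mapResolution (forgetGrading 𝒜) R (p.shift h).forgetIso)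
    change (augmentation (mapResolution (forgetGrading 𝒜) R (p.shift h).forgetIso)).hom x ∈ _
    rw [h₃]
    change _ ∈ p.component (g + h - h) at h₂
    rwa [add_sub_cancel_right] at h₂

/-- A graded map into Y(k) sends an element of original degree l, which has degree l + h after the
shift, to original degree l + h - k. Hence the cocycle is homogeneous of degree h - k. -/
theorem extForget_mem_extDegree (h k : G) (n : ℕ) (β : Ext (p.shift h).obj (q.shift k).obj n) :
    extForget K (p.shift h) (q.shift k) n β ∈
      extDegree 𝒜 X Y p.component q.component n (h - k) := by
  let R : ProjectiveResolution (p.shift h).obj := Classical.choice HasProjectiveResolution.out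
  obtain ⟨f, hf, rfl⟩ := R.extMk_surjective β (n + 1) rfl
  obtain ⟨hf', e⟩ := extConj_extMk_mapResolution K (forgetGrading 𝒜) R (p.shift h).forgetIso
    (q.shift k).forgetIso.hom f (n + 1) rfl hf
  refine Submodule.subset_span ⟨p.gradedResolution h R, _, hf', ?_, e.symm⟩
  intro l x hx
  have h₁ : Smash.idem 𝒜 (l + h) • (show R.complex.X n from x) = x :=
      (mem_component_ofForget _ _ _).1 hx
  have h₂ := (q.shift k).ofObj_hom_mem f (l + h) (show R.complex.X n from x) h₁
  change _ ∈ q.component (l + h - k) at h₂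
  rw [add_sub_assoc] at h₂
  exact h₂

end GradedProjections

namespace GradedResolution

variable {X Y : ModuleCat.{u} A} {p : GradedProjections 𝒜 X} (P : GradedResolution 𝒜 X p.component)

/-- The projections of the terms of a graded resolution. -/
def projections (n : ℕ) : GradedProjections 𝒜 (P.complex.X n) :=
  letI := (P.isInternal n).chooseDecomposition
  GradedProjections.ofDecomposition (P.grading n) (P.smul_mem n)

theorem mem_component_projections (n : ℕ) (g : G) (x : P.complex.X n) :
    x ∈ (P.projections n).component g ↔ x ∈ P.grading n g :=
  letI := (P.isInternal n).chooseDecomposition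
  GradedProjections.mem_component_ofDecomposition (P.grading n) (P.smul_mem n) g x

theorem d_mem_component (i j : ℕ) (g : G) (x : P.complex.X i)
    (hx : x ∈ (P.projections i).component g) :
    (P.complex.d i j).hom x ∈ (P.projections j).component g := by
  by_cases hij : (ComplexShape.down ℕ).Rel i j
  · obtain rfl : j + 1 = i := hij
    rw [mem_component_projections] at hx ⊢
    exact P.d_mem j g x hx
  · rw [P.complex.shape i j hij]
    exact zero_mem _

theorem d_mem_shift (h : G) (i j : ℕ) (g : G) (x : P.complex.X i)
    (hx : x ∈ ((P.projections i).shift h).component g) :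
    (P.complex.d i j).hom x ∈ ((P.projections j).shift h).component g :=
  P.d_mem_component i j (g - h) x hx

/-- A graded resolution as a complex over the smash product. -/
def smashComplex (h : G) : ChainComplex (ModuleCat.{u} (Smash 𝒜)) ℕ where
  X n := ((P.projections n).shift h).obj
  d i j := GradedProjections.liftHom ((P.projections i).shift h) ((P.projections j).shift h)
    (P.complex.d i j) (P.d_mem_shift h i j)
  shape i j hij := by
    ext x
    exact congrArg ((P.projections j).shift h).ofObj.symm
      (congrArg (fun φ => φ.hom (((P.projections i).shift h).ofObj x)) (P.complex.shape i j hij))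
  d_comp_d' i j k _ _ := GradedProjections.liftHom_comp_liftHom_eq_zero _ _ _ _ _ _ _
    (P.complex.d_comp_d i j k)

/-- Forgetting the grading of `GradedResolution.smashComplex`. -/
def forgetSmashComplexIso (h : G) :
    P.complex ≅ ((forgetGrading 𝒜).mapHomologicalComplex _).obj (P.smashComplex h) :=
  HomologicalComplex.Hom.isoOfComponents
    (fun n => ((P.projections n).shift h).forgetIso.symm) fun _ _ _ => rfl

theorem augmentation_mem_component (g : G) (x : P.complex.X 0)
    (hx : x ∈ (P.projections 0).component g) :
    (augmentation P.toProjectiveResolution).hom x ∈ p.component g :=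
  P.augmentation_mem g x ((P.mem_component_projections 0 g x).1 hx)

/-- The augmentation of a graded resolution as a map over the smash product. -/
def smashAugmentation (h : G) : (P.smashComplex h).X 0 ⟶ (p.shift h).obj :=
  GradedProjections.liftHom ((P.projections 0).shift h) (p.shift h)
    (augmentation P.toProjectiveResolution) fun g x hx => P.augmentation_mem_component (g - h) x hx

theorem d_comp_smashAugmentation (h : G) :
    (P.smashComplex h).d 1 0 ≫ P.smashAugmentation h = 0 := by
  have e : P.complex.d 1 0 ≫ augmentation P.toProjectiveResolution = 0 :=
    ProjectiveResolution.complex_d_comp_π_f_zero P.toProjectiveResolution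
  exact GradedProjections.liftHom_comp_liftHom_eq_zero ((P.projections 1).shift h)
    ((P.projections 0).shift h) (p.shift h) (P.complex.d 1 0)
    (augmentation P.toProjectiveResolution) (P.d_mem_shift h 1 0)
    (fun g x hx => P.augmentation_mem_component (g - h) x hx) e

/-- A graded resolution as a resolution over the smash product. -/
def smashResolution (h : G) : ProjectiveResolution (p.shift h).obj :=
  resolutionOfMap (forgetGrading 𝒜) P.toProjectiveResolution (P.smashComplex h)
    (fun n => projective_of_projective_forget _
      (Projective.of_iso ((P.projections n).shift h).forgetIso.symm (P.projective n)))
    (P.smashAugmentation h)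
    (P.d_comp_smashAugmentation h)
    (p.shift h).forgetIso.symm (P.forgetSmashComplexIso h) rfl

/-- The whole graded resolution, once shifted by h, lifts to a projective resolution over the smash
product, and a cocycle of degree h - k becomes a graded map into Y(k). The given class is the image
of the class of this lifted cocycle. -/
theorem extMk_mem_range (q : GradedProjections 𝒜 Y) (h k : G) {n : ℕ}
    (f : P.complex.X n ⟶ Y) (hf : P.complex.d (n + 1) n ≫ f = 0)
    (hf' : ∀ (l : G) (x : P.complex.X n), x ∈ P.grading n l →
      f.hom x ∈ q.component (l + (h - k))) :
    P.toProjectiveResolution.extMk f (n + 1) rfl hf ∈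
      LinearMap.range (GradedProjections.extForget K (p.shift h) (q.shift k) n) := by
  have hmem : ∀ g x, x ∈ ((P.projections n).shift h).component g →
      f.hom x ∈ (q.shift k).component g := by
    intro g x hx
    -- Degree g in the shift by h is original degree g - h; the cocycle sends it to (g - h) + (h -
    -- k) = g - k, which is degree g in Y(k).
    have := hf' (g - h) x ((P.mem_component_projections n (g - h) x).1 hx)
    rw [sub_add_sub_cancel] at this
    exact this
  let φ := GradedProjections.liftHom ((P.projections n).shift h) (q.shift k) f hmem
  have hφ : (P.smashComplex h).d (n + 1) n ≫ φ = 0 :=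
    GradedProjections.liftHom_comp_liftHom_eq_zero ((P.projections (n + 1)).shift h)
      ((P.projections n).shift h) (q.shift k) (P.complex.d (n + 1) n) f
      (P.d_mem_shift h (n + 1) n) hmem hf
  refine ⟨(P.smashResolution h).extMk φ (n + 1) rfl hφ, ?_⟩
  refine (extConj_extMk K (forgetGrading 𝒜) (P.smashResolution h) P.toProjectiveResolution
    (p.shift h).forgetIso.inv (q.shift k).forgetIso.hom (P.forgetSmashComplexIso h).hom ?_
    φ (n + 1) rfl hφ hf).trans rfl
  exact congrArg (fun ε => (P.forgetSmashComplexIso h).hom.f 0 ≫ (forgetGrading 𝒜).map ε)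
    (augmentation_resolutionOfMap _ _ _ _ _ _ _ _ _)

end GradedResolution

/-- Replaces a span over all graded resolutions by the image of one Ext group. Only the difference h
- k matters, so h and k can be chosen to suit a composition. -/
theorem extDegree_eq_range {X Y : ModuleCat.{u} A} (p : GradedProjections 𝒜 X)
    (q : GradedProjections 𝒜 Y) (n : ℕ) (h k : G) :
    extDegree 𝒜 X Y p.component q.component n (h - k) =
      LinearMap.range (GradedProjections.extForget K (p.shift h) (q.shift k) n) := by
  apply le_antisymm
  · refine Submodule.span_le.2 ?_
    rintro _ ⟨P, f, hf, hf', rfl⟩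
    exact P.extMk_mem_range q h k f hf hf'
  · rintro _ ⟨β, rfl⟩
    exact p.extForget_mem_extDegree q h k n β

end ExtDegree

/-! ### A criterion for internal direct sums -/

section Internal

variable {K : Type*} [Field K] {G : Type*} [Fintype G] [DecidableEq G]
  {E : Type*} [AddCommGroup E] [Module K E]

theorem isInternal_of_sum {V : G → Submodule K E}
    (h₁ : ∀ x, ∃ v : G → E, (∀ g, v g ∈ V g) ∧ ∑ g, v g = x)
    (h₂ : ∀ v : G → E, (∀ g, v g ∈ V g) → ∑ g, v g = 0 → ∀ g, v g = 0) :
    DirectSum.IsInternal V := by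
  have key : ∀ x : ⨁ g, V g, DirectSum.coeAddMonoidHom V x = ∑ g, (x g : E) := fun x =>
    (congrArg _ (DirectSum.sum_univ_of x).symm).trans (by
      simp only [map_sum, DirectSum.coeAddMonoidHom_of])
  constructor
  · rw [injective_iff_map_eq_zero]
    intro x hx
    rw [key] at hx
    exact DFinsupp.ext fun g => Subtype.ext (h₂ _ (fun g => (x g).2) hx g)
  · intro x
    obtain ⟨v, hv, rfl⟩ := h₁ x
    refine ⟨∑ g, DirectSum.of (fun g => V g) g ⟨v g, hv g⟩, ?_⟩
    rw [map_sum]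
    simp only [DirectSum.coeAddMonoidHom_of]

theorem coe_decompose_of_sum_eq {V : G → Submodule K E} [DirectSum.Decomposition V] {x : E}
    {v : G → E} (hv : ∀ g, v g ∈ V g) (hx : ∑ g, v g = x) (g : G) :
    (DirectSum.decompose V x g : E) = v g := by
  rw [← hx, DirectSum.decompose_sum, DirectSum.sum_apply, AddSubmonoidClass.coe_finsetSum,
    Finset.sum_eq_single g]
  · exact DirectSum.decompose_of_mem_same V (hv g)
  · intro h _ hh
    exact DirectSum.decompose_of_mem_ne V (hv h) hh
  · simp

end Internal

/-! ### Ext between direct sums of shifts as matrices -/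

section ShiftSum

variable {K : Type*} [Field K] {G : Type u} [AddGroup G] [Fintype G] [DecidableEq G]
  {A : Type u} [Ring A] [Algebra K A] {𝒜 : G → Submodule K A} [GradedAlgebra 𝒜]
  {X Y T : ModuleCat.{u} A}

namespace GradedProjections

theorem extForget_injective (p : GradedProjections 𝒜 X) (q : GradedProjections 𝒜 Y) (k : G)
    (n : ℕ) : Function.Injective (extForget K p (q.shift k) n) := by
  rw [injective_iff_map_eq_zero]
  intro β hβ
  have h := (bijective_sum_extForget (K := K) p q n).1 (a₁ := Pi.single k β) (a₂ := 0) (by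
    refine Finset.sum_congr rfl fun l _ => ?_
    by_cases hl : l = k
    · subst hl
      rw [Pi.single_eq_same, hβ, Pi.zero_apply, map_zero]
    · rw [Pi.single_eq_of_ne hl, Pi.zero_apply])
  simpa using congrFun h k

theorem exists_sum_mem_extDegree (p : GradedProjections 𝒜 X) (q : GradedProjections 𝒜 Y) (n : ℕ)
    (α : Ext X Y n) : ∃ v : G → Ext X Y n,
      (∀ g, v g ∈ extDegree 𝒜 X Y p.component q.component n g) ∧ ∑ g, v g = α := by
  obtain ⟨β, hβ⟩ := (bijective_sum_extForget (K := K) (p.shift 0) q n).2 α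
  -- The source shift is 0 and the target shift is -g, since 0 - (-g) = g.
  refine ⟨fun g => extForget K (p.shift 0) (q.shift (-g)) n (β (-g)), fun g => ?_, ?_⟩
  · have := extForget_mem_extDegree (K := K) p q 0 (-g) n (β (-g))
    rwa [sub_neg_eq_add, zero_add] at this
  · rw [← hβ]
    exact Fintype.sum_equiv (Equiv.neg G) _ _ fun _ => rfl

theorem eq_zero_of_sum_mem_extDegree (p : GradedProjections 𝒜 X) (q : GradedProjections 𝒜 Y)
    (n : ℕ) (v : G → Ext X Y n)
    (hv : ∀ g, v g ∈ extDegree 𝒜 X Y p.component q.component n g) (h : ∑ g, v g = 0) (g : G) :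
    v g = 0 := by
  have h₁ : ∀ k, ∃ β, extForget K (p.shift 0) (q.shift k) n β = v (-k) := by
    intro k
    have := hv (0 - k)
    rw [extDegree_eq_range] at this
    rwa [← zero_sub k]
  choose β hβ using h₁
  have h₂ := (bijective_sum_extForget (K := K) (p.shift 0) q n).1 (a₁ := β) (a₂ := 0) (by
    change ∑ k, extForget K (p.shift 0) (q.shift k) n (β k) =
      ∑ k, extForget K (p.shift 0) (q.shift k) n 0
    simp only [hβ, map_zero, Finset.sum_const_zero]
    rw [← h]
    exact Fintype.sum_equiv (Equiv.neg G) _ _ fun _ => rfl)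
  have h₃ := hβ (-g)
  rw [h₂, neg_neg, Pi.zero_apply, map_zero] at h₃
  exact h₃.symm

end GradedProjections

/-- A decomposition of a module over the smash product as the direct sum of all shifts of a graded
module. -/
structure ShiftSum (p : GradedProjections 𝒜 X) (Z : ModuleCat.{u} (Smash 𝒜)) where
  /-- the inclusions -/
  ι : ∀ h, (p.shift h).obj ⟶ Z
  /-- the projections -/
  pr : ∀ h, Z ⟶ (p.shift h).obj
  ι_pr : ∀ h, ι h ≫ pr h = 𝟙 _
  ι_pr_of_ne : ∀ h k, h ≠ k → ι h ≫ pr k = 0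
  sum_pr_ι : ∑ h, pr h ≫ ι h = 𝟙 Z

namespace ShiftSum

variable {p : GradedProjections 𝒜 X} {q : GradedProjections 𝒜 Y} {r : GradedProjections 𝒜 T}
  {Z W V : ModuleCat.{u} (Smash 𝒜)} (s : ShiftSum p Z) (t : ShiftSum q W) (w : ShiftSum r V)

variable (K) in
/-- The matrix entries of a class in `Ext`. -/
def entry (n : ℕ) (g k : G) : Ext Z W n →ₗ[K] Ext X Y n :=
  extConj K (forgetGrading 𝒜) ((p.shift g).forgetIso.inv ≫ (forgetGrading 𝒜).map (s.ι g))
    ((forgetGrading 𝒜).map (t.pr k) ≫ (q.shift k).forgetIso.hom) n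

theorem entry_eq_extForget {n : ℕ} (g k : G) (β : Ext Z W n) :
    entry K s t n g k β = GradedProjections.extForget K (p.shift g) (q.shift k) n
      ((Ext.mk₀ (s.ι g)).comp (β.comp (Ext.mk₀ (t.pr k)) (add_zero n)) (zero_add n)) := by
  refine Eq.trans ?_ (extConj_mk₀_comp K (forgetGrading 𝒜) _ _ _ _).symm
  exact (extConj_comp_mk₀ K (forgetGrading 𝒜) _ _ _ _).symm

theorem entry_mem {n : ℕ} (g k : G) (β : Ext Z W n) :
    entry K s t n g k β ∈ extDegree 𝒜 X Y p.component q.component n (g - k) := by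
  rw [entry_eq_extForget]
  exact p.extForget_mem_extDegree q g k n _

/-- The identity of `W` is the sum of its projections followed by its inclusions; inserting it
between the two factors gives the matrix product. -/
theorem entry_comp {n m l : ℕ} (hl : n + m = l) (g k : G) (β : Ext Z W n) (γ : Ext W V m) :
    entry K s w l g k (β.comp γ hl) =
      ∑ j, (entry K s t n g j β).comp (entry K t w m j k γ) hl := by
  refine (sum_extConj_comp_extConj K (forgetGrading 𝒜) _ _ _ _ ?_ hl β γ).symm
  have h : ∀ j, ((forgetGrading 𝒜).map (t.pr j) ≫ (q.shift j).forgetIso.hom) ≫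
      (q.shift j).forgetIso.inv ≫ (forgetGrading 𝒜).map (t.ι j) =
      (forgetGrading 𝒜).map (t.pr j ≫ t.ι j) := by
    intro j
    rw [Category.assoc, Iso.hom_inv_id_assoc, ← CategoryTheory.Functor.map_comp]
  simp only [h]
  rw [← CategoryTheory.Functor.map_sum, t.sum_pr_ι, CategoryTheory.Functor.map_id]

theorem entry_id (g k : G) :
    entry K s s 0 g k (Ext.mk₀ (𝟙 Z)) = if g = k then Ext.mk₀ (𝟙 X) else 0 := by
  rw [entry_eq_extForget, Ext.mk₀_id_comp, Ext.mk₀_comp_mk₀]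
  split_ifs with h
  · subst h
    rw [s.ι_pr]
    exact (p.shift g).extForget_id
  · rw [s.ι_pr_of_ne g k h, Ext.mk₀_zero, map_zero]

variable (K) in
/-- The column sums of the matrix of a class in `Ext`. -/
def column (n : ℕ) : Ext Z W n →ₗ[K] (G → Ext X Y n) :=
  LinearMap.pi fun k => ∑ g, entry K s t n g k

theorem column_apply {n : ℕ} (β : Ext Z W n) (k : G) :
    column K s t n β k = ∑ g, entry K s t n g k β := by
  simp [column]

/-- Since the entry at (j, k) is the part of degree j - k of column k, this is the multiplication
formula of the smash product. -/
theorem column_comp {n m l : ℕ} (hl : n + m = l) (β : Ext Z W n) (γ : Ext W V m) (k : G) :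
    column K s w l (β.comp γ hl) k =
      ∑ j, (column K s t n β j).comp (entry K t w m j k γ) hl := by
  simp only [column_apply, entry_comp s t w hl, Ext.sum_comp]
  exact Finset.sum_comm

theorem eq_sum_mk₀_comp {n : ℕ} (β : Ext Z W n) :
    β = ∑ g, ∑ k, (Ext.mk₀ (s.pr g)).comp
      (((Ext.mk₀ (s.ι g)).comp (β.comp (Ext.mk₀ (t.pr k)) (add_zero n)) (zero_add n)).comp
        (Ext.mk₀ (t.ι k)) (add_zero n)) (zero_add n) := by
  have h : ∀ g k, (Ext.mk₀ (s.pr g)).comp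
      (((Ext.mk₀ (s.ι g)).comp (β.comp (Ext.mk₀ (t.pr k)) (add_zero n)) (zero_add n)).comp
        (Ext.mk₀ (t.ι k)) (add_zero n)) (zero_add n) =
      (Ext.mk₀ (s.pr g ≫ s.ι g)).comp (β.comp (Ext.mk₀ (t.pr k ≫ t.ι k)) (add_zero n))
        (zero_add n) := by
    intro g k
    rw [Ext.comp_assoc_of_third_deg_zero, Ext.comp_assoc_of_third_deg_zero, Ext.mk₀_comp_mk₀,
      Ext.mk₀_comp_mk₀_assoc]
  simp only [h]
  simp only [← Ext.comp_sum, ← Ext.sum_comp, ← Ext.mk₀_sum]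
  rw [s.sum_pr_ι, t.sum_pr_ι, Ext.mk₀_id_comp, Ext.comp_mk₀_id]

/-- The entries of one column lie in pairwise distinct degrees, so a zero column sum forces every
entry to vanish, and a class is determined by its entries. -/
theorem column_injective (n : ℕ) : Function.Injective (column K s t n) := by
  rw [injective_iff_map_eq_zero]
  intro β hβ
  have h : ∀ g k, entry K s t n g k β = 0 := by
    intro g k
    -- Column k is reindexed by h = g - k, so that the index is the degree of the entry.
    have h₁ := p.eq_zero_of_sum_mem_extDegree (K := K) q n (fun h => entry K s t n (h + k) k β)
      (fun h => by simpa using entry_mem (K := K) s t (h + k) k β) (by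
        refine Eq.trans ?_ (congrFun hβ k)
        rw [column_apply]
        exact Fintype.sum_equiv (Equiv.addRight k) _ _ fun _ => rfl) (g - k)
    simpa using h₁
  rw [eq_sum_mk₀_comp s t β]
  refine Finset.sum_eq_zero fun g _ => Finset.sum_eq_zero fun k _ => ?_
  have h₁ := h g k
  rw [entry_eq_extForget, ← map_zero (GradedProjections.extForget K (p.shift g) (q.shift k) n)]
    at h₁
  rw [(p.shift g).extForget_injective q k n h₁, Ext.zero_comp, Ext.comp_zero]

/-- The (g, k) entry is taken to be the component of degree g - k of the prescribed column sum; it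
lifts to Ext(X(g), Y(k)) by `extDegree_eq_range`. -/
theorem column_surjective (n : ℕ) : Function.Surjective (column K s t n) := by
  intro a
  have h₁ : ∀ g k, ∃ b : Ext (p.shift g).obj (q.shift k).obj n,
      GradedProjections.extForget K (p.shift g) (q.shift k) n b =
        (p.exists_sum_mem_extDegree (K := K) q n (a k)).choose (g - k) := by
    intro g k
    have := (p.exists_sum_mem_extDegree (K := K) q n (a k)).choose_spec.1 (g - k)
    rwa [extDegree_eq_range] at this
  choose b hb using h₁
  refine ⟨∑ i, ∑ j, (Ext.mk₀ (s.pr i)).comp ((b i j).comp (Ext.mk₀ (t.ι j)) (add_zero n))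
    (zero_add n), funext fun k => ?_⟩
  rw [column_apply]
  refine Eq.trans ?_ ((Fintype.sum_equiv (Equiv.subRight k) (fun g =>
    (p.exists_sum_mem_extDegree (K := K) q n (a k)).choose (g - k)) _ fun _ => rfl).trans
      (p.exists_sum_mem_extDegree (K := K) q n (a k)).choose_spec.2)
  refine Finset.sum_congr rfl fun g _ => ?_
  refine Eq.trans ?_ (hb g k)
  have h₂ : ∀ i j, entry K s t n g k ((Ext.mk₀ (s.pr i)).comp
      ((b i j).comp (Ext.mk₀ (t.ι j)) (add_zero n)) (zero_add n)) =
      GradedProjections.extForget K (p.shift g) (q.shift k) n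
        ((Ext.mk₀ (s.ι g ≫ s.pr i)).comp ((b i j).comp (Ext.mk₀ (t.ι j ≫ t.pr k))
          (add_zero n)) (zero_add n)) := by
    intro i j
    rw [entry_eq_extForget, Ext.comp_assoc_of_third_deg_zero, Ext.comp_assoc_of_third_deg_zero,
      Ext.mk₀_comp_mk₀, Ext.mk₀_comp_mk₀_assoc]
  simp only [map_sum, h₂]
  rw [Finset.sum_eq_single g, Finset.sum_eq_single k]
  · rw [s.ι_pr, t.ι_pr, Ext.mk₀_id_comp, Ext.comp_mk₀_id]
  · intro j _ hj
    rw [t.ι_pr_of_ne j k hj, Ext.mk₀_zero, Ext.comp_zero, Ext.comp_zero, map_zero]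
  · simp
  · intro i _ hi
    refine Finset.sum_eq_zero fun j _ => ?_
    rw [s.ι_pr_of_ne g i (Ne.symm hi), Ext.mk₀_zero, Ext.zero_comp, map_zero]
  · simp

end ShiftSum

end ShiftSum

/-! ### The Jacobson radical of the smash product -/

section Jacobson

variable {K : Type*} [Field K] {G : Type*} [AddGroup G] [Fintype G] [DecidableEq G]
  {A : Type*} [Ring A] [Algebra K A] (𝒜 : G → Submodule K A) [GradedAlgebra 𝒜]

theorem sum_proj_sub_left (a : A) (g : G) : ∑ h, GradedRing.proj 𝒜 (g - h) a = a := by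
  rw [Fintype.sum_equiv (Equiv.subLeft g) (fun h => GradedRing.proj 𝒜 (g - h) a)
    (fun h => GradedRing.proj 𝒜 (h - 0) a) fun _ => by simp, sum_proj_sub]

/-! ### Coinduced modules -/

/-- The module over the smash product coinduced from an `A`-module `M`. -/
def Coinduced (_𝒜 : G → Submodule K A) (M : Type*) : Type _ := G → M

section Coinduced

variable {M : Type*} [AddCommGroup M] [Module A M]

instance : AddCommGroup (Coinduced 𝒜 M) := inferInstanceAs (AddCommGroup (G → M))

instance : SMul (Smash 𝒜) (Coinduced 𝒜 M) where
  smul x m := fun g => ∑ h, GradedRing.proj 𝒜 (g - h) (x h) • m h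

theorem Coinduced.smul_apply (x : Smash 𝒜) (m : Coinduced 𝒜 M) (g : G) :
    (x • m) g = ∑ h, GradedRing.proj 𝒜 (g - h) (x h) • m h := rfl

theorem Coinduced.add_apply (m n : Coinduced 𝒜 M) (g : G) : (m + n) g = m g + n g := rfl

theorem Coinduced.zero_apply (g : G) : (0 : Coinduced 𝒜 M) g = 0 := rfl

instance : Module (Smash 𝒜) (Coinduced 𝒜 M) where
  one_smul m := by
    funext g
    simp only [Coinduced.smul_apply, Smash.one_apply, proj_sub_one, ite_smul, one_smul, zero_smul]
    exact Fintype.sum_ite_eq g m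
  mul_smul x y m := by
    funext g
    simp only [Coinduced.smul_apply, Smash.mul_apply, map_sum, proj_mul_proj, Finset.sum_smul,
      Finset.smul_sum, mul_smul]
    exact Finset.sum_comm
  smul_zero x := by
    funext g
    simp only [Coinduced.smul_apply, Coinduced.zero_apply, smul_zero, Finset.sum_const_zero]
  zero_smul m := by
    funext g
    simp only [Coinduced.smul_apply, Coinduced.zero_apply, Smash.zero_apply, map_zero, zero_smul,
      Finset.sum_const_zero]
  smul_add x m n := by
    funext g
    simp only [Coinduced.smul_apply, Coinduced.add_apply, smul_add, Finset.sum_add_distrib]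
  add_smul x y m := by
    funext g
    simp only [Coinduced.smul_apply, Coinduced.add_apply, Smash.add_apply, map_add, add_smul,
      Finset.sum_add_distrib]

/-- The coinduced submodule. -/
def Coinduced.submodule (L : Submodule A M) : Submodule (Smash 𝒜) (Coinduced 𝒜 M) where
  carrier := {m | ∀ g, m g ∈ L}
  zero_mem' _ := L.zero_mem
  add_mem' hm hn g := L.add_mem (hm g) (hn g)
  smul_mem' x m hm g := by
    rw [Coinduced.smul_apply]
    exact L.sum_mem fun h _ => L.smul_mem _ (hm h)

/-- The diagonal map. -/
def Coinduced.diag : M →+ Coinduced 𝒜 M where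
  toFun m := fun _ => m
  map_zero' := rfl
  map_add' _ _ := rfl

theorem Coinduced.const_smul_diag (a : A) (m : M) :
    Smash.const 𝒜 a • Coinduced.diag 𝒜 m = Coinduced.diag 𝒜 (a • m) := by
  funext g
  change ∑ h, GradedRing.proj 𝒜 (g - h) a • m = a • m
  rw [← Finset.sum_smul, sum_proj_sub_left]

/-- The sum of the coordinates. -/
def Coinduced.sum : Coinduced 𝒜 M →+ M where
  toFun m := ∑ g, m g
  map_zero' := Finset.sum_const_zero
  map_add' _ _ := Finset.sum_add_distrib

theorem Coinduced.sum_const_smul (a : A) (m : Coinduced 𝒜 M) :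
    Coinduced.sum 𝒜 (Smash.const 𝒜 a • m) = a • Coinduced.sum 𝒜 m := by
  have key : ∀ m : G → M, ∑ g, ∑ h, GradedRing.proj 𝒜 (g - h) a • m h = a • ∑ g, m g := by
    intro m
    rw [Finset.sum_comm, Finset.smul_sum]
    refine Finset.sum_congr rfl fun h _ => ?_
    rw [← Finset.sum_smul, sum_proj_sub]
  exact key m

theorem Coinduced.sum_diag (m : M) :
    Coinduced.sum 𝒜 (Coinduced.diag 𝒜 m) = Fintype.card G • m := by
  change ∑ g : G, m = _
  rw [Finset.sum_const, Finset.card_univ]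

/-- Maschke's argument. The maps `Coinduced.diag` and `Coinduced.sum` are `A`-linear and compose to
multiplication by |G|; a retraction of coinduced modules, placed between them and divided by |G|, is
a retraction of `M` onto `L`. -/
theorem isSemisimpleModule_of_coinduced [Invertible (Fintype.card G : A)]
    [IsSemisimpleModule (Smash 𝒜) (Coinduced 𝒜 M)] : IsSemisimpleModule A M := by
  rw [isSemisimpleModule_iff]
  refine ⟨fun L => ?_⟩
  obtain ⟨π, hπ⟩ := IsSemisimpleModule.extension_property
    (Coinduced.submodule 𝒜 L).subtype (Submodule.subtype_injective _) LinearMap.id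
  have hmem : ∀ m, Coinduced.sum 𝒜 (π (Coinduced.diag 𝒜 m) : Coinduced 𝒜 M) ∈ L := fun m =>
    L.sum_mem fun g _ => (π (Coinduced.diag 𝒜 m)).2 g
  have hcomm : ∀ a : A, a * ⅟(Fintype.card G : A) = ⅟(Fintype.card G : A) * a := fun a =>
    ((Nat.cast_commute (Fintype.card G) a).symm.invOf_right).eq
  let r : M →ₗ[A] L :=
    { toFun m := ⟨⅟(Fintype.card G : A) • Coinduced.sum 𝒜
        (π (Coinduced.diag 𝒜 m) : Coinduced 𝒜 M), L.smul_mem _ (hmem m)⟩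
      map_add' m n := by
        ext
        simp only [map_add, Submodule.coe_add, smul_add]
      map_smul' a m := by
        ext
        simp only [← Coinduced.const_smul_diag, map_smul, Submodule.coe_smul,
          Coinduced.sum_const_smul, RingHom.id_apply]
        rw [← mul_smul, ← mul_smul, hcomm] }
  refine ⟨_, LinearMap.isCompl_of_proj (f := r) fun m => ?_⟩
  have h₁ : Coinduced.diag 𝒜 (m : M) ∈ Coinduced.submodule 𝒜 L := fun _ => m.2
  have h₂ : π (Coinduced.diag 𝒜 (m : M)) = ⟨_, h₁⟩ := LinearMap.congr_fun hπ ⟨_, h₁⟩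
  ext
  change ⅟(Fintype.card G : A) • Coinduced.sum 𝒜
    (π (Coinduced.diag 𝒜 (m : M)) : Coinduced 𝒜 M) = m
  rw [h₂]
  change ⅟(Fintype.card G : A) • Coinduced.sum 𝒜 (Coinduced.diag 𝒜 (m : M)) = m
  rw [Coinduced.sum_diag, ← Nat.cast_smul_eq_nsmul A, ← mul_smul, invOf_mul_self, one_smul]

end Coinduced

/-! ### The radical of the smash product -/

/-- Translation of the indices is an automorphism of the smash product. -/
def Smash.translate (l : G) : Smash 𝒜 →+* Smash 𝒜 where
  toFun x := fun h => x (h + l)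
  map_one' := rfl
  map_zero' := rfl
  map_add' _ _ := rfl
  map_mul' x y := by
    funext h
    refine (Smash.mul_apply 𝒜 x y (h + l)).trans (Eq.trans ?_ (Smash.mul_apply 𝒜 _ _ h).symm)
    refine (Fintype.sum_equiv (Equiv.addRight l) _ _ fun g => ?_).symm
    change x (g + l) * GradedRing.proj 𝒜 (g - h) (y (h + l)) =
      x (g + l) * GradedRing.proj 𝒜 (g + l - (h + l)) (y (h + l))
    rw [add_sub_add_right_eq_sub]

instance (l : G) : RingHomSurjective (Smash.translate 𝒜 l) :=
  ⟨fun x => ⟨fun h => x (h - l), funext fun h => congrArg x (add_sub_cancel_right h l)⟩⟩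

theorem Smash.translate_single (a : A) (g : G) :
    Smash.translate 𝒜 g (Smash.single 𝒜 a g) = Smash.single 𝒜 a 0 := by
  funext h
  change Smash.single 𝒜 a g (h + g) = _
  rw [Smash.single_apply, Smash.single_apply]
  simp only [add_eq_right]

theorem Smash.translate_single_zero (a : A) (g : G) :
    Smash.translate 𝒜 (-g) (Smash.single 𝒜 a 0) = Smash.single 𝒜 a g := by
  funext h
  change Smash.single 𝒜 a 0 (h + -g) = _
  rw [Smash.single_apply, Smash.single_apply]
  simp only [← sub_eq_add_neg, sub_eq_zero]

theorem Smash.mul_idem (x : Smash 𝒜) (g : G) :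
    x * Smash.idem 𝒜 g = Smash.single 𝒜 (x g) g := by
  conv_lhs => rw [← Smash.sum_single 𝒜 x, Finset.sum_mul]
  rw [Finset.sum_eq_single g]
  · rw [← Smash.const_mul_idem, mul_assoc, Smash.idem_mul_idem, if_pos rfl]
  · intro h _ hh
    rw [← Smash.const_mul_idem, mul_assoc, Smash.idem_mul_idem, if_neg hh, mul_zero]
  · simp

/-- Translations are surjective endomorphisms and so carry the radical into itself, and they move
any index to 0 and back. Thus one ideal of coefficients serves all indices. -/
theorem Smash.single_mem_jacobson_iff (a : A) (g : G) :
    Smash.single 𝒜 a g ∈ Ring.jacobson (Smash 𝒜) ↔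
      Smash.single 𝒜 a 0 ∈ Ring.jacobson (Smash 𝒜) := by
  constructor
  · intro h
    rw [← Smash.translate_single 𝒜 a g]
    exact Ring.le_comap_jacobson (Smash.translate 𝒜 g) h
  · intro h
    rw [← Smash.translate_single_zero 𝒜 a g]
    exact Ring.le_comap_jacobson (Smash.translate 𝒜 (-g)) h

theorem Smash.mem_jacobson_iff_single (x : Smash 𝒜) :
    x ∈ Ring.jacobson (Smash 𝒜) ↔
      ∀ g, Smash.single 𝒜 (x g) 0 ∈ Ring.jacobson (Smash 𝒜) := by
  constructor
  · intro h g
    rw [← Smash.single_mem_jacobson_iff 𝒜 (x g) g, ← Smash.mul_idem]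
    exact Ideal.IsTwoSided.mul_mem_of_left _ h
  · intro h
    rw [← Smash.sum_single 𝒜 x]
    exact Ideal.sum_mem _ fun g _ => (Smash.single_mem_jacobson_iff 𝒜 (x g) g).2 (h g)

theorem Smash.single_add (a b : A) (g : G) :
    Smash.single 𝒜 (a + b) g = Smash.single 𝒜 a g + Smash.single 𝒜 b g :=
  Pi.single_add (f := fun _ => A) g a b

theorem Smash.single_zero (g : G) : Smash.single 𝒜 0 g = 0 := Pi.single_zero g

/-- The ideal of `A` that generates the radical of the smash product. -/
def radicalCoefficients : Ideal A where
  carrier := {a | Smash.single 𝒜 a 0 ∈ Ring.jacobson (Smash 𝒜)}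
  zero_mem' := by
    change Smash.single 𝒜 0 0 ∈ Ring.jacobson (Smash 𝒜)
    rw [Smash.single_zero]
    exact zero_mem _
  add_mem' {a b} ha hb := by
    change Smash.single 𝒜 (a + b) 0 ∈ Ring.jacobson (Smash 𝒜)
    rw [Smash.single_add]
    exact add_mem ha hb
  smul_mem' b a ha := by
    change Smash.single 𝒜 (b * a) 0 ∈ Ring.jacobson (Smash 𝒜)
    rw [← Smash.const_mul_single]
    exact Ideal.mul_mem_left _ _ ha

theorem mem_radicalCoefficients (a : A) :
    a ∈ radicalCoefficients 𝒜 ↔ Smash.single 𝒜 a 0 ∈ Ring.jacobson (Smash 𝒜) := Iff.rfl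

/-- Left multiplication by the idempotent p_g extracts the component of degree g, and the radical is
a left ideal. Homogeneity of J is obtained from this. -/
theorem proj_mem_radicalCoefficients {a : A} (ha : a ∈ radicalCoefficients 𝒜) (g : G) :
    GradedRing.proj 𝒜 g a ∈ radicalCoefficients 𝒜 := by
  rw [mem_radicalCoefficients] at ha ⊢
  have := Ideal.mul_mem_left (Ring.jacobson (Smash 𝒜)) (Smash.idem 𝒜 g) ha
  rwa [Smash.idem_mul_single, sub_zero] at this

theorem const_mem_jacobson_iff (a : A) :
    Smash.const 𝒜 a ∈ Ring.jacobson (Smash 𝒜) ↔ a ∈ radicalCoefficients 𝒜 := by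
  rw [Smash.mem_jacobson_iff_single]
  exact ⟨fun h => h 0, fun h _ => h⟩

instance : (radicalCoefficients 𝒜).IsTwoSided where
  mul_mem_of_left {a} b ha := by
    rw [← const_mem_jacobson_iff] at ha ⊢
    rw [map_mul]
    exact Ideal.IsTwoSided.mul_mem_of_left _ ha

/-- A quasi-inverse over the smash product is a family of coefficients; averaging them gives a
quasi-inverse in `A`. -/
theorem radicalCoefficients_le_jacobson [Invertible (Fintype.card G : A)] :
    radicalCoefficients 𝒜 ≤ Ring.jacobson A := by
  intro a ha
  rw [← Ideal.jacobson_bot, Ideal.mem_jacobson_iff]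
  intro b
  rw [← const_mem_jacobson_iff, ← Ideal.jacobson_bot, Ideal.mem_jacobson_iff] at ha
  obtain ⟨z, hz⟩ := ha (Smash.const 𝒜 b)
  rw [Ideal.mem_bot, sub_eq_zero, mul_assoc, ← map_mul] at hz
  -- Adding the coordinate equations over all h reassembles `c` from its components and turns the
  -- right side into |G|.
  have key : ∀ (z : G → A) (c : A), (∀ h, ∑ g, z g * GradedRing.proj 𝒜 (g - h) c + z h = 1) →
      (∑ g, z g) * c + ∑ g, z g = Fintype.card G := by
    intro z c hz
    have h₂ : ∑ h, (∑ g, z g * GradedRing.proj 𝒜 (g - h) c + z h) = ∑ _h : G, (1 : A) :=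
      Finset.sum_congr rfl fun h _ => hz h
    rw [Finset.sum_const, Finset.card_univ, nsmul_one, Finset.sum_add_distrib,
      Finset.sum_comm] at h₂
    simpa only [← Finset.mul_sum, sum_proj_sub_left, ← Finset.sum_mul] using h₂
  have h₁ := key z (b * a) fun h => congrFun hz h
  refine ⟨⅟(Fintype.card G : A) * ∑ g, z g, ?_⟩
  rw [Ideal.mem_bot, sub_eq_zero, mul_assoc, mul_assoc, ← mul_add, h₁, invOf_mul_self]

/-- Let I be the ideal of radical coefficients. The module coinduced from A/I is killed by the
radical of an artinian ring, hence semisimple. Then A/I is semisimple over `A`, so J annihilates it,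
and applying this to the class of 1 gives J ≤ I. -/
theorem jacobson_le_radicalCoefficients [Module.Finite K A] [Invertible (Fintype.card G : A)] :
    Ring.jacobson A ≤ radicalCoefficients 𝒜 := by
  have : Module.Finite K (Smash 𝒜) := inferInstanceAs (Module.Finite K (G → A))
  have : IsArtinianRing (Smash 𝒜) := IsArtinianRing.of_finite K (Smash 𝒜)
  have : IsSemisimpleModule (Smash 𝒜) (Coinduced 𝒜 (A ⧸ radicalCoefficients 𝒜)) := by
    have ht : Module.IsTorsionBySet (Smash 𝒜) (Coinduced 𝒜 (A ⧸ radicalCoefficients 𝒜))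
        (Ring.jacobson (Smash 𝒜)) := by
      rintro m ⟨x, hx⟩
      funext g
      change ∑ h, GradedRing.proj 𝒜 (g - h) (x h) • m h = 0
      refine Finset.sum_eq_zero fun h _ => ?_
      obtain ⟨c, hc⟩ := Submodule.Quotient.mk_surjective _ (m h)
      rw [← hc, ← Submodule.Quotient.mk_smul, Submodule.Quotient.mk_eq_zero]
      exact Ideal.IsTwoSided.mul_mem_of_left _
        (proj_mem_radicalCoefficients 𝒜 ((Smash.mem_jacobson_iff_single 𝒜 x).1 hx h) _)
    let := ht.module
    exact ht.isSemisimpleModule_iff.1 inferInstance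
  have := isSemisimpleModule_of_coinduced 𝒜 (M := A ⧸ radicalCoefficients 𝒜)
  intro a ha
  have h := Module.mem_annihilator.1
    (IsSemisimpleModule.jacobson_le_annihilator A (A ⧸ radicalCoefficients 𝒜) ha)
    (Submodule.Quotient.mk 1)
  rwa [← Submodule.Quotient.mk_smul, Submodule.Quotient.mk_eq_zero, smul_eq_mul, mul_one] at h

variable [Module.Finite K A] [Invertible (Fintype.card G : A)]

theorem radicalCoefficients_eq_jacobson : radicalCoefficients 𝒜 = Ring.jacobson A :=
  le_antisymm (radicalCoefficients_le_jacobson 𝒜) (jacobson_le_radicalCoefficients 𝒜)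

theorem isHomogeneous_jacobson : (Ring.jacobson A).IsHomogeneous 𝒜 := by
  rw [← radicalCoefficients_eq_jacobson 𝒜]
  exact fun g a ha => proj_mem_radicalCoefficients 𝒜 ha g

theorem Smash.mem_jacobson_iff (x : Smash 𝒜) :
    x ∈ Ring.jacobson (Smash 𝒜) ↔ ∀ g, x g ∈ Ring.jacobson A := by
  rw [Smash.mem_jacobson_iff_single, ← radicalCoefficients_eq_jacobson 𝒜]
  rfl

end Jacobson

/-! ### Direct sums of shifts: M ⊗ KG^* and the semisimple top -/

section Top

variable {K : Type*} [Field K] {G : Type u} [AddGroup G] [Fintype G] [DecidableEq G]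
  {A : Type u} [Ring A] [Algebra K A] {𝒜 : G → Submodule K A} [GradedAlgebra 𝒜]

/-- A module over the smash product whose elements are families with the appropriate action is
the direct sum of the shifts. -/
def ShiftSum.ofEquiv {X : ModuleCat.{u} A} (p : GradedProjections 𝒜 X)
    (Z : ModuleCat.{u} (Smash 𝒜)) (e : Z ≃+ (G → X))
    (he : ∀ (x : Smash 𝒜) (z : Z) (k : G), e (x • z) k = ∑ g, x g • p.proj (g - k) (e z k)) :
    ShiftSum p Z where
  ι k := ModuleCat.ofHom
    { toFun m := e.symm (Pi.single k ((p.shift k).ofObj m))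
      map_add' := map_add (e.symm.toAddMonoidHom.comp
        ((AddMonoidHom.single (fun _ : G => X) k).comp (p.shift k).ofObj.toAddMonoidHom))
      map_smul' x m := by
        apply e.injective
        funext l
        rw [AddEquiv.apply_symm_apply, RingHom.id_apply, he, AddEquiv.apply_symm_apply]
        by_cases hl : l = k
        · subst hl
          simp only [Pi.single_eq_same]
          exact (p.shift l).act_apply x m
        · simp only [Pi.single_eq_of_ne hl, map_zero, smul_zero, Finset.sum_const_zero] }
  pr k := ModuleCat.ofHom
    { toFun z := (p.shift k).ofObj.symm (e z k)
      map_add' := map_add ((p.shift k).ofObj.symm.toAddMonoidHom.comp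
        ((Pi.evalAddMonoidHom (fun _ : G => X) k).comp e.toAddMonoidHom))
      map_smul' x z := by
        rw [he]
        exact ((p.shift k).smul_toMod x (e z k)).symm }
  ι_pr k := by
    ext m
    change (p.shift k).ofObj.symm (e (e.symm (Pi.single k ((p.shift k).ofObj m))) k) = m
    rw [AddEquiv.apply_symm_apply, Pi.single_eq_same, AddEquiv.symm_apply_apply]
  ι_pr_of_ne h k hk := by
    ext m
    change (p.shift k).ofObj.symm (e (e.symm (Pi.single h ((p.shift h).ofObj m))) k) = 0
    rw [AddEquiv.apply_symm_apply, Pi.single_eq_of_ne (Ne.symm hk), map_zero]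
  sum_pr_ι := by
    ext z
    rw [ModuleCat.hom_sum, LinearMap.sum_apply]
    change ∑ h, e.symm (Pi.single h ((p.shift h).ofObj ((p.shift h).ofObj.symm (e z h)))) = z
    simp only [AddEquiv.apply_symm_apply]
    rw [← map_sum, Finset.univ_sum_single, AddEquiv.symm_apply_apply]

/-- The projections of a graded module. -/
abbrev moduleProjections {M : Type u} [AddCommGroup M] [Module K M] [Module A M]
    (ℳ : G → Submodule K M) [DirectSum.Decomposition ℳ] [SetLike.GradedSMul 𝒜 ℳ] :
    GradedProjections 𝒜 (ModuleCat.of A M) :=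
  GradedProjections.ofDecomposition (M := M) ℳ
    fun _ _ _ _ ha hm => SetLike.GradedSMul.smul_mem ha hm

/-- `M ⊗ KG^*` is the direct sum of the shifts of `M`. -/
def smashModuleShiftSum {M : Type u} [AddCommGroup M] [Module K M] [Module A M]
    (ℳ : G → Submodule K M) [DirectSum.Decomposition ℳ] [SetLike.GradedSMul 𝒜 ℳ] :
    ShiftSum (moduleProjections ℳ) (ModuleCat.of (Smash 𝒜) (SmashModule 𝒜 ℳ)) :=
  ShiftSum.ofEquiv (moduleProjections ℳ) (ModuleCat.of (Smash 𝒜) (SmashModule 𝒜 ℳ))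
    (AddEquiv.refl (G → M)) fun _ _ _ => rfl

section

variable (hJ : (Ring.jacobson A).IsHomogeneous 𝒜)

/-- The projections of `A / J`. -/
def topProjections : GradedProjections 𝒜 (semisimpleTop A) where
  proj g := QuotientAddGroup.map _ _ (GradedRing.proj 𝒜 g) fun _ ha => hJ g ha
  proj_proj g h m := by
    obtain ⟨a, rfl⟩ := Submodule.Quotient.mk_surjective _ m
    change Submodule.Quotient.mk (GradedRing.proj 𝒜 g (GradedRing.proj 𝒜 h a)) = _
    rw [proj_proj]
    split_ifs
    · rfl
    · rfl
  sum_proj m := by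
    obtain ⟨a, rfl⟩ := Submodule.Quotient.mk_surjective _ m
    change ∑ g, (Ring.jacobson A).mkQ (GradedRing.proj 𝒜 g a) = (Ring.jacobson A).mkQ a
    rw [← map_sum]
    congr 1
    simpa using sum_proj_sub 𝒜 a 0
  proj_smul g a m := by
    obtain ⟨b, rfl⟩ := Submodule.Quotient.mk_surjective _ m
    change (Ring.jacobson A).mkQ (GradedRing.proj 𝒜 g (a * b)) =
      ∑ h, (Ring.jacobson A).mkQ (GradedRing.proj 𝒜 (g - h) a * GradedRing.proj 𝒜 h b)
    rw [← map_sum]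
    congr 1
    have h₁ := sum_proj_sub 𝒜 b 0
    simp only [sub_zero] at h₁
    conv_lhs => rw [← h₁, Finset.mul_sum, map_sum]
    refine Finset.sum_congr rfl fun h _ => ?_
    simpa using proj_mul_proj 𝒜 a b g h 0

theorem component_topProjections : (topProjections hJ).component = topGrading 𝒜 := by
  funext g
  ext m
  rw [GradedProjections.mem_component, topGrading, AddSubgroup.mem_map]
  constructor
  · intro h
    obtain ⟨a, rfl⟩ := Submodule.Quotient.mk_surjective _ m
    exact ⟨GradedRing.proj 𝒜 g a, SetLike.coe_mem (DirectSum.decompose 𝒜 a g), h⟩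
  · rintro ⟨a, ha, rfl⟩
    change (Ring.jacobson A).mkQ (GradedRing.proj 𝒜 g a) = (Ring.jacobson A).mkQ a
    rw [proj_of_mem ha, if_pos rfl]

variable (hS : ∀ x : Smash 𝒜, x ∈ Ring.jacobson (Smash 𝒜) ↔ ∀ g, x g ∈ Ring.jacobson A)

/-- The map from the quotient of the smash product by its radical to the families of elements of
`A / J`. -/
def topHom : semisimpleTop (Smash 𝒜) →+ (G → semisimpleTop A) :=
  QuotientAddGroup.lift (Ring.jacobson (Smash 𝒜)).toAddSubgroup
    (AddMonoidHom.pi fun k => (Ring.jacobson A).mkQ.toAddMonoidHom.comp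
      (Pi.evalAddMonoidHom (fun _ : G => A) k))
    fun x hx => funext fun k => (Submodule.Quotient.mk_eq_zero _).2 ((hS x).1 hx k)

theorem topHom_bijective : Function.Bijective (topHom hS) := by
  constructor
  · rw [injective_iff_map_eq_zero]
    intro z hz
    obtain ⟨x, rfl⟩ := Submodule.Quotient.mk_surjective _ z
    refine (Submodule.Quotient.mk_eq_zero _).2 ((hS x).2 fun k => ?_)
    exact (Submodule.Quotient.mk_eq_zero _).1 (congrFun hz k)
  · intro m
    choose a ha using fun k => Submodule.Quotient.mk_surjective _ (m k)
    exact ⟨Submodule.Quotient.mk (show Smash 𝒜 from a), funext ha⟩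

/-- `(A # G^*) / J(A # G^*)` is the direct sum of the shifts of `A / J`. -/
def topShiftSum : ShiftSum (topProjections hJ) (semisimpleTop (Smash 𝒜)) :=
  ShiftSum.ofEquiv (topProjections hJ) (semisimpleTop (Smash 𝒜)) 
    (AddEquiv.ofBijective (topHom hS) (topHom_bijective hS)) fun x z k => by
    obtain ⟨y, rfl⟩ := Submodule.Quotient.mk_surjective _ z
    change (Ring.jacobson A).mkQ (∑ g, x g * GradedRing.proj 𝒜 (g - k) (y k)) = _
    rw [map_sum]
    rfl

end

end Top

/-! ### Quasi-Koszul modules -/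

section KoszulModule

variable {K : Type*} [Field K] {G : Type u} [AddGroup G] [Fintype G] [DecidableEq G]
  {A : Type u} [Ring A] [Algebra K A] {𝒜 : G → Submodule K A} [GradedAlgebra 𝒜]
  {X Y T : ModuleCat.{u} A} {p : GradedProjections 𝒜 X} {q : GradedProjections 𝒜 Y}
  {r : GradedProjections 𝒜 T} {Z W V : ModuleCat.{u} (Smash 𝒜)}

/-- When all columns of `α` equal `a`, the entries in each column of `β` are added up again after
multiplication by `a`. Such an `α` plays the role of the element ∑ g, a # p_g. -/
theorem ShiftSum.column_comp_of_const (s : ShiftSum p Z) (t : ShiftSum q W) (w : ShiftSum r V)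
    {n m l : ℕ} (hl : n + m = l) (α : Ext Z W n) (β : Ext W V m) (a : Ext X Y n)
    (hα : s.column K t n α = fun _ => a) (k : G) :
    s.column K w l (α.comp β hl) k = a.comp (t.column K w m β k) hl := by
  rw [column_comp s t w hl, hα, column_apply, Ext.comp_sum]

/-- The span of the products of classes in `Ext`. -/
abbrev extProducts (K : Type*) [Field K] {R : Type u} [Ring R] [Algebra K R]
    (L M N : ModuleCat.{u} R) (i : ℕ) : Submodule K (Ext L N (i + 1)) :=
  Submodule.span K {γ | ∃ (α : Ext L M i) (β : Ext M N 1), α.comp β rfl = γ}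

/-- Each column of a product is a sum of products over `A`. Conversely, a product ab placed in
column k is the product of the class with constant column a and the class with b in column k only,
and such classes span. -/
theorem ShiftSum.extProducts_eq_top_iff (s : ShiftSum p Z) (t : ShiftSum q W) (w : ShiftSum r V)
    (i : ℕ) : extProducts K Z W V i = ⊤ ↔ extProducts K X Y T i = ⊤ := by
  constructor
  · intro h
    rw [eq_top_iff]
    intro c _
    -- Only column 0 of γ is used, so any class with `c` in that column would do.
    obtain ⟨γ, hγ⟩ := s.column_surjective (K := K) w (i + 1) fun _ => c
    have hle : extProducts K Z W V i ≤ (extProducts K X Y T i).comap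
        ((LinearMap.proj (0 : G)) ∘ₗ s.column K w (i + 1)) := by
      refine Submodule.span_le.2 ?_
      rintro _ ⟨α, β, rfl⟩
      change s.column K w (i + 1) (α.comp β rfl) 0 ∈ extProducts K X Y T i
      rw [column_comp s t w rfl]
      exact Submodule.sum_mem _ fun j _ => Submodule.subset_span ⟨_, _, rfl⟩
    have := hle (h ▸ Submodule.mem_top : γ ∈ extProducts K Z W V i)
    change s.column K w (i + 1) γ 0 ∈ extProducts K X Y T i at this
    rwa [hγ] at this
  · intro h
    have hsingle : ∀ (k : G) (c : Ext X T (i + 1)), ∀ γ : Ext Z V (i + 1),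
        s.column K w (i + 1) γ = Pi.single k c → γ ∈ extProducts K Z W V i := by
      intro k
      have hle : extProducts K X Y T i ≤ ((extProducts K Z W V i).map
          (s.column K w (i + 1))).comap (LinearMap.single K (fun _ : G => Ext X T (i + 1)) k) := by
        refine Submodule.span_le.2 ?_
        rintro _ ⟨a, b, rfl⟩
        obtain ⟨α, hα⟩ := s.column_surjective (K := K) t i fun _ => a
        obtain ⟨β, hβ⟩ := t.column_surjective (K := K) w 1 (Pi.single k b)
        refine ⟨α.comp β rfl, Submodule.subset_span ⟨α, β, rfl⟩, funext fun l => ?_⟩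
        rw [s.column_comp_of_const t w rfl α β a hα, hβ, LinearMap.single_apply]
        by_cases hl : l = k
        · subst hl
          rw [Pi.single_eq_same, Pi.single_eq_same]
        · rw [Pi.single_eq_of_ne hl, Pi.single_eq_of_ne hl, Ext.comp_zero]
      intro c γ hγ
      obtain ⟨γ', hγ', e⟩ := hle (h ▸ Submodule.mem_top : c ∈ extProducts K X Y T i)
      rwa [s.column_injective (K := K) w (i + 1) (hγ.trans e.symm)]
    rw [eq_top_iff]
    intro γ _
    choose δ hδ using fun k => s.column_surjective (K := K) w (i + 1)
      (Pi.single k (s.column K w (i + 1) γ k))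
    have : γ = ∑ k, δ k := by
      apply s.column_injective (K := K) w (i + 1)
      rw [map_sum]
      simp only [hδ]
      exact (Finset.univ_sum_single _).symm
    rw [this]
    exact Submodule.sum_mem _ fun k _ => hsingle k _ (δ k) (hδ k)

theorem isQuasiKoszulModule_smash_iff (hJ : (Ring.jacobson A).IsHomogeneous 𝒜)
    (hS : ∀ x : Smash 𝒜, x ∈ Ring.jacobson (Smash 𝒜) ↔ ∀ g, x g ∈ Ring.jacobson A)
    {M : Type u} [AddCommGroup M] [Module K M] [Module A M] (ℳ : G → Submodule K M)
    [DirectSum.Decomposition ℳ] [SetLike.GradedSMul 𝒜 ℳ] :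
    IsQuasiKoszulModule K (Smash 𝒜) (SmashModule 𝒜 ℳ) ↔ IsQuasiKoszulModule K A M :=
  forall_congr' fun i => (smashModuleShiftSum ℳ).extProducts_eq_top_iff (topShiftSum hJ hS)
    (topShiftSum hJ hS) i

end KoszulModule

/-! ### The Yoneda algebra as a graded algebra -/

section YonedaGrading

variable {K : Type*} [Field K] {G : Type u} [AddGroup G] [Fintype G] [DecidableEq G]
  {A : Type u} [Ring A] [Algebra K A] {𝒜 : G → Submodule K A} [GradedAlgebra 𝒜]

theorem GradedProjections.comp_mem_extDegree {X Y T : ModuleCat.{u} A}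
    (p : GradedProjections 𝒜 X) (q : GradedProjections 𝒜 Y) (r : GradedProjections 𝒜 T)
    {n m l : ℕ} (hl : n + m = l) {g h : G} {α : Ext X Y n} {β : Ext Y T m}
    (hα : α ∈ extDegree 𝒜 X Y p.component q.component n g)
    (hβ : β ∈ extDegree 𝒜 Y T q.component r.component m h) :
    α.comp β hl ∈ extDegree 𝒜 X T p.component r.component l (g + h) := by
  -- The shifts g + h, h and 0 have successive differences g and h, so the two lifts are composable
  -- over the smash product.
  have h₁ : α ∈ LinearMap.range (extForget K (p.shift (g + h)) (q.shift h) n) := by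
    rw [← extDegree_eq_range, add_sub_cancel_right]
    exact hα
  have h₂ : β ∈ LinearMap.range (extForget K (q.shift h) (r.shift 0) m) := by
    rw [← extDegree_eq_range, sub_zero]
    exact hβ
  obtain ⟨α', rfl⟩ := h₁
  obtain ⟨β', rfl⟩ := h₂
  have h₃ := p.extForget_mem_extDegree (K := K) r (g + h) 0 l (α'.comp β' hl)
  rw [sub_zero] at h₃
  rw [extForget_comp]
  exact h₃

theorem GradedProjections.id_mem_extDegree {X : ModuleCat.{u} A} (p : GradedProjections 𝒜 X) :
    (Ext.mk₀ (𝟙 X)) ∈ extDegree 𝒜 X X p.component p.component 0 0 := by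
  have := p.extForget_mem_extDegree (K := K) p 0 0 0 (Ext.mk₀ (𝟙 _))
  rwa [extForget_id, sub_zero] at this

variable (hJ : (Ring.jacobson A).IsHomogeneous 𝒜)

theorem mem_yonedaGrading (g : G) (x : Yoneda A) :
    x ∈ yonedaGrading 𝒜 g ↔ ∀ i, x i ∈ extDegree 𝒜 (semisimpleTop A) (semisimpleTop A)
      (topProjections hJ).component (topProjections hJ).component i g := by
  rw [yonedaGrading, Submodule.mem_iInf, component_topProjections]
  rfl

theorem of_mem_yonedaGrading {g : G} {i : ℕ} {α : SelfExt (semisimpleTop A) i}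
    (hα : α ∈ extDegree 𝒜 (semisimpleTop A) (semisimpleTop A)
      (topProjections hJ).component (topProjections hJ).component i g) :
    DirectSum.of (SelfExt (semisimpleTop A)) i α ∈ yonedaGrading 𝒜 g := by
  rw [mem_yonedaGrading hJ]
  intro j
  by_cases hij : i = j
  · subst hij
    rwa [DirectSum.of_eq_same]
  · rw [DirectSum.of_eq_of_ne _ _ _ (Ne.symm hij)]
    exact zero_mem _

theorem exists_sum_mem_yonedaGrading (hJ : (Ring.jacobson A).IsHomogeneous 𝒜) (x : Yoneda A) :
    ∃ v : G → Yoneda A, (∀ g, v g ∈ yonedaGrading 𝒜 g) ∧ ∑ g, v g = x := by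
  induction x using DirectSum.induction_on with
  | zero => exact ⟨0, fun g => zero_mem _, by simp⟩
  | of i α =>
    obtain ⟨v, hv, hα⟩ := (topProjections hJ).exists_sum_mem_extDegree (K := K)
      (topProjections hJ) i α
    refine ⟨fun g => DirectSum.of (SelfExt (semisimpleTop A)) i (v g),
      fun g => of_mem_yonedaGrading hJ (hv g), ?_⟩
    rw [← map_sum, hα]
  | add x y hx hy =>
    obtain ⟨v, hv, rfl⟩ := hx
    obtain ⟨w, hw, rfl⟩ := hy
    exact ⟨v + w, fun g => add_mem (hv g) (hw g), Finset.sum_add_distrib⟩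

theorem isInternal_yonedaGrading (hJ : (Ring.jacobson A).IsHomogeneous 𝒜) :
    DirectSum.IsInternal (yonedaGrading 𝒜) :=
  isInternal_of_sum (exists_sum_mem_yonedaGrading hJ) fun v hv hsum g => DFinsupp.ext fun i =>
    (topProjections hJ).eq_zero_of_sum_mem_extDegree (K := K) (topProjections hJ) i
      (fun g => v g i) (fun g => (mem_yonedaGrading hJ g _).1 (hv g) i)
      (by rw [← DirectSum.sum_apply, hsum]; rfl) g

/-- The Yoneda algebra of `A / J` is graded by `G`. -/
abbrev yonedaGradedAlgebra : GradedAlgebra (yonedaGrading 𝒜) where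
  toDecomposition := (isInternal_yonedaGrading hJ).chooseDecomposition
  one_mem := of_mem_yonedaGrading hJ (topProjections hJ).id_mem_extDegree
  mul_mem {g h} x y hx hy := by
    classical
    rw [← DirectSum.sum_support_of x, ← DirectSum.sum_support_of y, Finset.sum_mul]
    refine Submodule.sum_mem _ fun i _ => ?_
    rw [Finset.mul_sum]
    refine Submodule.sum_mem _ fun j _ => ?_
    rw [DirectSum.of_mul_of]
    exact of_mem_yonedaGrading hJ ((topProjections hJ).comp_mem_extDegree (topProjections hJ)
      (topProjections hJ) rfl ((mem_yonedaGrading hJ g x).1 hx i)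
      ((mem_yonedaGrading hJ h y).1 hy j))

/-- Homogeneous decompositions are unique, so any decomposition of `α` inside Ext^i computes its
projections in the whole Yoneda algebra. -/
theorem proj_yonedaGrading_of [GradedAlgebra (yonedaGrading 𝒜)] {i : ℕ}
    {α : SelfExt (semisimpleTop A) i} {v : G → SelfExt (semisimpleTop A) i}
    (hv : ∀ g, v g ∈ extDegree 𝒜 (semisimpleTop A) (semisimpleTop A)
      (topProjections hJ).component (topProjections hJ).component i g)
    (hα : ∑ g, v g = α) (g : G) :
    GradedRing.proj (yonedaGrading 𝒜) g (DirectSum.of (SelfExt (semisimpleTop A)) i α) =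
      DirectSum.of (SelfExt (semisimpleTop A)) i (v g) := by
  rw [GradedRing.proj_apply]
  refine coe_decompose_of_sum_eq (v := fun g => DirectSum.of (SelfExt (semisimpleTop A)) i (v g))
    (fun g => of_mem_yonedaGrading hJ (hv g)) ?_ g
  rw [← map_sum, hα]

/-! ### The isomorphism of Yoneda algebras -/

variable (hS : ∀ x : Smash 𝒜, x ∈ Ring.jacobson (Smash 𝒜) ↔ ∀ g, x g ∈ Ring.jacobson A)

variable (K) in
/-- The column sums as a linear equivalence. -/
def columnEquiv (i : ℕ) : SelfExt (semisimpleTop (Smash 𝒜)) i ≃ₗ[K]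
    (G → SelfExt (semisimpleTop A) i) :=
  LinearEquiv.ofBijective ((topShiftSum hJ hS).column K (topShiftSum hJ hS) i)
    ⟨(topShiftSum hJ hS).column_injective _ i, (topShiftSum hJ hS).column_surjective _ i⟩

theorem columnEquiv_apply {i : ℕ} (α : SelfExt (semisimpleTop (Smash 𝒜)) i) :
    columnEquiv K hJ hS i α = (topShiftSum hJ hS).column K (topShiftSum hJ hS) i α := rfl

/-- The coordinates of the isomorphism of Yoneda algebras. -/
def yonedaCoordinate (k : G) : Yoneda (Smash 𝒜) →ₗ[K] Yoneda A :=
  DirectSum.lmap fun i => LinearMap.proj k ∘ₗ (columnEquiv K hJ hS i).toLinearMap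

theorem yonedaCoordinate_of (k : G) {i : ℕ} (α : SelfExt (semisimpleTop (Smash 𝒜)) i) :
    yonedaCoordinate (K := K) hJ hS k (DirectSum.of (SelfExt (semisimpleTop (Smash 𝒜))) i α) =
      DirectSum.of (SelfExt (semisimpleTop A)) i (columnEquiv K hJ hS i α k) :=
  DirectSum.lmap_of _ _ _

theorem yonedaCoordinate_apply (k : G) (x : Yoneda (Smash 𝒜)) (i : ℕ) :
    yonedaCoordinate (K := K) hJ hS k x i = columnEquiv K hJ hS i (x i) k := rfl

/-- The inverse of the isomorphism of Yoneda algebras. -/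
def yonedaInverse : (G → Yoneda A) →ₗ[K] Yoneda (Smash 𝒜) :=
  ∑ k, (DirectSum.lmap fun i => (columnEquiv K hJ hS i).symm.toLinearMap ∘ₗ
    LinearMap.single K (fun _ : G => SelfExt (semisimpleTop A) i) k) ∘ₗ LinearMap.proj k

theorem yonedaInverse_apply (y : G → Yoneda A) (i : ℕ) :
    yonedaInverse (K := K) hJ hS y i = (columnEquiv K hJ hS i).symm fun k => y k i := by
  rw [yonedaInverse, LinearMap.sum_apply, DirectSum.sum_apply]
  change ∑ k, (columnEquiv K hJ hS i).symm (Pi.single k (y k i)) = _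
  rw [← map_sum]
  congr 1
  exact Finset.univ_sum_single (fun k => y k i)

/-- The isomorphism of Yoneda algebras as a linear equivalence. -/
def yonedaLinearEquiv : Yoneda (Smash 𝒜) ≃ₗ[K] Smash (yonedaGrading 𝒜) :=
  LinearEquiv.ofLinearMap (M₂ := G → Yoneda A) (LinearMap.pi (yonedaCoordinate hJ hS))
    (yonedaInverse hJ hS)
    (by
      refine LinearMap.ext fun y => funext fun k => DFinsupp.ext fun i => ?_
      change yonedaCoordinate (K := K) hJ hS k (yonedaInverse hJ hS y) i = y k i
      rw [yonedaCoordinate_apply, yonedaInverse_apply, LinearEquiv.apply_symm_apply])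
    (by
      refine LinearMap.ext fun x => DFinsupp.ext fun i => ?_
      change yonedaInverse (K := K) hJ hS (fun k => yonedaCoordinate hJ hS k x) i = x i
      rw [yonedaInverse_apply]
      simp only [yonedaCoordinate_apply]
      exact LinearEquiv.symm_apply_apply _ _)

theorem yonedaLinearEquiv_apply (x : Yoneda (Smash 𝒜)) (k : G) :
    yonedaLinearEquiv (K := K) hJ hS x k = yonedaCoordinate (K := K) hJ hS k x := rfl

section Multiplicative

variable [GradedAlgebra (yonedaGrading 𝒜)]

theorem yonedaLinearEquiv_one : yonedaLinearEquiv (K := K) hJ hS 1 = 1 := by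
  funext k
  rw [yonedaLinearEquiv_apply, Smash.one_apply]
  refine (yonedaCoordinate_of hJ hS k (Ext.mk₀ (𝟙 _))).trans ?_
  refine congrArg (DirectSum.of (SelfExt (semisimpleTop A)) 0) ?_
  rw [columnEquiv_apply, ShiftSum.column_apply]
  simp only [ShiftSum.entry_id]
  rw [Finset.sum_ite_eq' Finset.univ k, if_pos (Finset.mem_univ k)]
  rfl

theorem yonedaLinearEquiv_of_mul_of {i j : ℕ} (α : SelfExt (semisimpleTop (Smash 𝒜)) i)
    (β : SelfExt (semisimpleTop (Smash 𝒜)) j) :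
    yonedaLinearEquiv (K := K) hJ hS (DirectSum.of (SelfExt (semisimpleTop (Smash 𝒜))) i α *
      DirectSum.of (SelfExt (semisimpleTop (Smash 𝒜))) j β) =
    yonedaLinearEquiv hJ hS (DirectSum.of (SelfExt (semisimpleTop (Smash 𝒜))) i α) *
      yonedaLinearEquiv hJ hS (DirectSum.of (SelfExt (semisimpleTop (Smash 𝒜))) j β) := by
  funext k
  rw [Smash.mul_apply]
  simp only [yonedaLinearEquiv_apply, yonedaCoordinate_of, DirectSum.of_mul_of]
  -- The entries of column k form its homogeneous decomposition, so its part of degree g - k is the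
  -- entry at (g, k).
  have hproj : ∀ g, GradedRing.proj (yonedaGrading 𝒜) (g - k)
      (DirectSum.of (SelfExt (semisimpleTop A)) j (columnEquiv K hJ hS j β k)) =
      DirectSum.of (SelfExt (semisimpleTop A)) j
        ((topShiftSum hJ hS).entry K (topShiftSum hJ hS) j g k β) := by
    intro g
    refine (proj_yonedaGrading_of hJ (v := fun h =>
      (topShiftSum hJ hS).entry K (topShiftSum hJ hS) j (h + k) k β) (fun h => ?_) ?_ (g - k)).trans
      (by simp only [sub_add_cancel])
    · simpa using (topShiftSum hJ hS).entry_mem (K := K) (topShiftSum hJ hS) (h + k) k β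
    · rw [columnEquiv_apply, ShiftSum.column_apply]
      exact Fintype.sum_equiv (Equiv.addRight k) _ _ fun _ => rfl
  simp only [hproj, DirectSum.of_mul_of]
  rw [← map_sum]
  refine congrArg (DirectSum.of (SelfExt (semisimpleTop A)) (i + j)) ?_
  exact (topShiftSum hJ hS).column_comp (topShiftSum hJ hS) (topShiftSum hJ hS) rfl α β k

theorem yonedaLinearEquiv_mul (x y : Yoneda (Smash 𝒜)) :
    yonedaLinearEquiv (K := K) hJ hS (x * y) =
      yonedaLinearEquiv hJ hS x * yonedaLinearEquiv hJ hS y := by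
  induction x using DirectSum.induction_on with
  | zero => rw [zero_mul, map_zero, zero_mul]
  | of i α =>
    induction y using DirectSum.induction_on with
    | zero => rw [mul_zero, map_zero, mul_zero]
    | of j β => exact yonedaLinearEquiv_of_mul_of hJ hS α β
    | add y z hy hz => rw [mul_add, map_add, hy, hz, map_add, mul_add]
  | add x z hx hz => rw [add_mul, map_add, hx, hz, map_add, add_mul]

/-- The isomorphism of Yoneda algebras. -/
def yonedaEquiv : Yoneda (Smash 𝒜) ≃ₐ[K] Smash (yonedaGrading 𝒜) :=
  AlgEquiv.ofLinearEquiv (yonedaLinearEquiv hJ hS) (yonedaLinearEquiv_one hJ hS)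
    (yonedaLinearEquiv_mul hJ hS)

theorem map_yonedaEquiv_yonedaDegree (i : ℕ) :
    (yonedaDegree K (Smash 𝒜) i).map (yonedaEquiv (K := K) hJ hS).toLinearMap =
      smashSubmodule (yonedaGrading 𝒜) (yonedaDegree K A i) := by
  apply le_antisymm
  · rintro _ ⟨_, ⟨α, rfl⟩, rfl⟩
    intro k _
    exact ⟨columnEquiv K hJ hS i α k, (yonedaCoordinate_of hJ hS k α).symm⟩
  · intro y hy
    choose c hc using fun k => hy k (Set.mem_univ k)
    refine ⟨_, ⟨(columnEquiv K hJ hS i).symm c, rfl⟩, funext fun k => ?_⟩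
    refine (yonedaCoordinate_of hJ hS k _).trans ?_
    rw [LinearEquiv.apply_symm_apply]
    exact hc k

end Multiplicative

end YonedaGrading

/-! ### Products and powers of the subspaces S # G^* -/

section SmashSubmodule

variable {K : Type*} [Field K] {G : Type*} [AddGroup G] [Fintype G] [DecidableEq G]
  {B : Type*} [Ring B] [Algebra K B] (ℬ : G → Submodule K B) [GradedAlgebra ℬ]

theorem mem_smashSubmodule (U : Submodule K B) (x : Smash ℬ) :
    x ∈ smashSubmodule ℬ U ↔ ∀ g, x g ∈ U :=
  ⟨fun h g => h g (Set.mem_univ g), fun h g _ => h g⟩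

theorem smashSubmodule_injective : Function.Injective (smashSubmodule ℬ) := by
  intro U V h
  ext b
  have key : ∀ W : Submodule K B, Smash.const ℬ b ∈ smashSubmodule ℬ W ↔ b ∈ W := fun W => by
    rw [mem_smashSubmodule]
    exact ⟨fun h => h 0, fun h _ => h⟩
  rw [← key, h, key]

/-- A product in the smash product involves components of the right factor, so `U` has to be stable
under projections. In the other direction, (ab) # p_k is the product of the constant family a and b
# p_k. -/
theorem smashSubmodule_mul (V U : Submodule K B)
    (hU : ∀ g, ∀ b ∈ U, GradedRing.proj ℬ g b ∈ U) :
    smashSubmodule ℬ V * smashSubmodule ℬ U = smashSubmodule ℬ (V * U) := by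
  apply le_antisymm
  · rw [Submodule.mul_le]
    intro x hx y hy
    rw [mem_smashSubmodule] at hx hy ⊢
    intro h
    rw [Smash.mul_apply]
    exact Submodule.sum_mem _ fun g _ => Submodule.mul_mem_mul (hx g) (hU _ _ (hy h))
  · intro x hx
    rw [mem_smashSubmodule] at hx
    rw [← Smash.sum_single ℬ x]
    refine Submodule.sum_mem _ fun k _ => ?_
    have hle : V * U ≤ (smashSubmodule ℬ V * smashSubmodule ℬ U).comap
        (LinearMap.single K (fun _ : G => B) k : B →ₗ[K] Smash ℬ) := by
      rw [Submodule.mul_le]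
      intro a ha b hb
      change Smash.single ℬ (a * b) k ∈ smashSubmodule ℬ V * smashSubmodule ℬ U
      rw [← Smash.const_mul_single]
      refine Submodule.mul_mem_mul ((mem_smashSubmodule ℬ _ _).2 fun _ => ha)
        ((mem_smashSubmodule ℬ _ _).2 fun g => ?_)
      rw [Smash.single_apply]
      split_ifs
      · exact hb
      · exact zero_mem _
    exact hle (hx k)

/-- The exponent is positive because the zeroth power is the line through 1, whereas the subspace
built from K · 1 contains every p_g. -/
theorem smashSubmodule_pow (U : Submodule K B) (hU : ∀ g, ∀ b ∈ U, GradedRing.proj ℬ g b ∈ U)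
    (n : ℕ) : smashSubmodule ℬ U ^ (n + 1) = smashSubmodule ℬ (U ^ (n + 1)) := by
  induction n with
  | zero => rw [zero_add, pow_one, pow_one]
  | succ n ih => rw [pow_succ, ih, smashSubmodule_mul ℬ _ U hU, ← pow_succ]

end SmashSubmodule

/-! ### Quasi-Koszul algebras -/

section KoszulAlgebra

variable {K : Type*} [Field K] {G : Type u} [AddGroup G] [Fintype G] [DecidableEq G]
  {A : Type u} [Ring A] [Algebra K A] {𝒜 : G → Submodule K A} [GradedAlgebra 𝒜]

theorem proj_mem_yonedaDegree (hJ : (Ring.jacobson A).IsHomogeneous 𝒜)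
    [GradedAlgebra (yonedaGrading 𝒜)] (i : ℕ) (g : G) (x : Yoneda A) (hx : x ∈ yonedaDegree K A i) :
    GradedRing.proj (yonedaGrading 𝒜) g x ∈ yonedaDegree K A i := by
  obtain ⟨α, rfl⟩ := hx
  obtain ⟨v, hv, hα⟩ := (topProjections hJ).exists_sum_mem_extDegree (K := K)
    (topProjections hJ) i α
  exact ⟨v g, (proj_yonedaGrading_of hJ hv hα g).symm⟩

/-- The isomorphism carries E_i and E_1^i of the smash product to the subspaces built from those of
`A`, and a subspace is recovered from the subspace it generates in this way. -/
theorem isQuasiKoszulAlgebra_smash_iff (hJ : (Ring.jacobson A).IsHomogeneous 𝒜)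
    [GradedAlgebra (yonedaGrading 𝒜)] (e : Yoneda (Smash 𝒜) ≃ₐ[K] Smash (yonedaGrading 𝒜))
    (he : ∀ i, (yonedaDegree K (Smash 𝒜) i).map e.toLinearMap =
      smashSubmodule (yonedaGrading 𝒜) (yonedaDegree K A i)) :
    IsQuasiKoszulAlgebra K (Smash 𝒜) ↔ IsQuasiKoszulAlgebra K A := by
  refine forall_congr' fun i => forall_congr' fun hi => ?_
  obtain ⟨n, rfl⟩ := Nat.exists_eq_add_of_le' (show 1 ≤ i by lia)
  rw [← (Submodule.map_injective_of_injective e.injective).eq_iff (f := Submodule.map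
    e.toLinearMap), he]
  have h : (yonedaDegree K (Smash 𝒜) 1 ^ (n + 1)).map e.toLinearMap =
      smashSubmodule (yonedaGrading 𝒜) (yonedaDegree K A 1 ^ (n + 1)) := by
    rw [← smashSubmodule_pow _ _ (proj_mem_yonedaDegree hJ 1), ← he 1]
    exact Submodule.map_pow (yonedaDegree K (Smash 𝒜) 1) e.toAlgHom (n + 1)
  rw [h]
  exact (smashSubmodule_injective (yonedaGrading 𝒜)).eq_iff

end KoszulAlgebra

end QuasiKoszul

end

theorem theorem3 {K : Type*} [Field K] {G : Type u} [AddGroup G] [Fintype G] [DecidableEq G]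
    (hG : ¬ ringChar K ∣ Fintype.card G)
    {A : Type u} [Ring A] [Algebra K A] [Module.Finite K A]
    (𝒜 : G → Submodule K A) [GradedAlgebra 𝒜] :
    (∀ (M : Type u) [AddCommGroup M] [Module K M] [Module A M] [IsScalarTower K A M]
        [Module.Finite A M] (ℳ : G → Submodule K M) [DirectSum.Decomposition ℳ]
        [SetLike.GradedSMul 𝒜 ℳ],
        IsQuasiKoszulModule K (Smash 𝒜) (SmashModule 𝒜 ℳ) ↔ IsQuasiKoszulModule K A M) ∧
    (IsQuasiKoszulAlgebra K (Smash 𝒜) ↔ IsQuasiKoszulAlgebra K A) ∧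
    (Ring.jacobson A).IsHomogeneous 𝒜 ∧
    ∃ (_ : GradedAlgebra (yonedaGrading 𝒜))
      (e : Yoneda (Smash 𝒜) ≃ₐ[K] Smash (yonedaGrading 𝒜)),
      ∀ i, (yonedaDegree K (Smash 𝒜) i).map e.toLinearMap =
        smashSubmodule (yonedaGrading 𝒜) (yonedaDegree K A i) := by
  have hK : (Fintype.card G : K) ≠ 0 := fun h => hG ((ringChar.spec K _).1 h)
  -- The inverse of |G| exists already in `K`, and its image in `A` is used for the averages.
  let _ : Invertible (Fintype.card G : A) :=
    { invOf := algebraMap K A (Fintype.card G : K)⁻¹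
      invOf_mul_self := by
        rw [← map_natCast (algebraMap K A), ← map_mul, inv_mul_cancel₀ hK, map_one]
      mul_invOf_self := by
        rw [← map_natCast (algebraMap K A), ← map_mul, mul_inv_cancel₀ hK, map_one] }
  have hJ := isHomogeneous_jacobson 𝒜
  have hS := Smash.mem_jacobson_iff 𝒜
  let _ : GradedAlgebra (yonedaGrading 𝒜) := yonedaGradedAlgebra hJ
  have he := map_yonedaEquiv_yonedaDegree (K := K) hJ hS
  exact ⟨fun M _ _ _ _ _ ℳ _ _ => isQuasiKoszulModule_smash_iff hJ hS ℳ,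
    isQuasiKoszulAlgebra_smash_iff hJ (yonedaEquiv hJ hS) he, hJ, inferInstance,
    yonedaEquiv hJ hS, he⟩
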